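/- Consider the planar Newtonian four-body problem with masses $m_1=m_2=m_3=1$, $m_4=m$, total mass $M=3+m$, and mutual distances $r_{ij}$. Write $\mathbf x=(\lambda_0,\mu,r_{12},r_{13},r_{14},r_{23},r_{24},r_{34})\in\mathbb R^8$ and $$U=\sum_{i<j}\frac{m_im_j}{r_{ij}},\qquad I=\frac1M\sum_{i<j}m_im_jr_{ij}^2,\qquad S=\det\begin{bmatrix}0&1&1&1&1\\1&0&r_{12}^2&r_{13}^2&r_{14}^2\\1&r_{12}^2&0&r_{23}^2&r_{24}^2\\1&r_{13}^2&r_{23}^2&0&r_{34}^2\\1&r_{14}^2&r_{24}^2&r_{34}^2&0\end{bmatrix},\qquad V=U+\lambda_0(I-1)+\mu S.$$ Let $F(\cdot,m):\mathbb R^8\to\mathbb R^8$ be the Dziobek map obtained from the partial derivatives of $V$ by clearing denominators, $$F=\Bigl(M\,\tfrac{\partial V}{\partial\lambda_0},\ \tfrac{\partial V}{\partial\mu},\ M r_{ij}^2\,\tfrac{\partial V}{\partial r_{ij}}\ (1\le i<j\le 4)\Bigr)$$ (a polynomial map). $DF$ and $D^2F$ denote derivatives with respect to $\mathbf x$, and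 $F_m$ the derivative with respect to $m$. A decimal number followed by $?$ denotes the closed interval of numbers that differ from it by at most one unit in its last displayed digit, and $0.?\times10^{-9}$ denotes $[-10^{-9},10^{-9}]$. **Theorem.** In the box $$[\mathbf x^*]=\begin{bmatrix}4.10486749931246396567394557?\\0.7904883951465367?\\0.98742601345654?\\0.57921860462471?\\1.00549177029900?\\0.57921860462471?\\1.00549177029900?\\0.57304559793134?\end{bmatrix},\qquad [m^*]=1.00266054757261000068580350?$$ there is exactly one $(\mathbf x^*,m^*)\in[\mathbf x^*]\times[m^*]$ with $F(\mathbf x^*,m^*)=0$ and $\det DF(\mathbf x^*,m^*)=0$. Moreover: 1. $\mathbf x^*$ is $\mathbb Z_2$-symmetric, i.e. $r_{13}=r_{23}$ and $r_{14}=r_{24}$, and its last six entries are the mutual distances of a planar central configuration $(q_1,q_2,q_3,q_4)$ of the masses $(1,1,1,m^*)$ in which $q_3$ lies in the interior of the convex hull of $q_1,q_2,q_4$. (Central configuration: the $q_i$ are distinct and, for some $\lambda\in\mathbb R$, $\lambda(q_j-q_G)=\sum_{i\ne j}m_i(q_i-q_j)/r_{ij}^3$ for all $j$, where $q_G$ is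 the centre of mass.) 2. The kernel of $A=DF(\mathbf x^*,m^*)$ is one-dimensional, and there are $\mathbf v,\mathbf w$ with $A\mathbf v=0$, $A^T\mathbf w=0$ and $$\mathbf v\in\begin{bmatrix}0.?\times10^{-9}\\-0.179026448?\\2.989514215?\\-0.5496816801?\\-1.4331568126?\\-0.5496816801?\\-1.4331568126?\\1\end{bmatrix},\qquad \mathbf w\in\begin{bmatrix}0.?\times10^{-9}\\-0.235312131?\\1.0068617795?\\-0.5380276784?\\-0.46549501352?\\-0.5380276784?\\-0.46549501352?\\1\end{bmatrix},$$ $$\mathbf w^TF_m(\mathbf x^*,m^*)\in-6.501134640?,\qquad \mathbf w^T[D^2F(\mathbf x^*,m^*)(\mathbf v,\mathbf v)]\in-2066.64414?\,;$$ in particular both numbers are nonzero. 3. The equation $F(\mathbf x,m)=0$ has a fold (saddle-node) bifurcation at $(\mathbf x^*,m^*)$, with the solutions on the side $m<m^*$. That is: near $(\mathbf x^*,m^*)$ the zero set of $F$ is a smooth curve $s\mapsto(\gamma(s),\mu(s))$, $|s|<\delta$, with $\gamma$ injective, $\gamma(0)=\mathbf x^*$, $\mu(0)=m^*$, $\gamma'(0)\ne0$,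 $\mu'(0)=0$, $\mu''(0)<0$; and every neighbourhood of $\mathbf x^*$ contains a neighbourhood $\mathcal U$ of $\mathbf x^*$ for which there is $\varepsilon>0$ such that, in $\mathcal U$, the equation $F(\mathbf x,m)=0$ has exactly two solutions if $m^*-\varepsilon<m<m^*$, only the solution $\mathbf x^*$ if $m=m^*$, and no solution if $m^*<m<m^*+\varepsilon$. -/

import Mathlib

open scoped Topology ContDiff

noncomputable section

namespace FourBody

/-! Planar four-body problem with masses `m₁ = m₂ = m₃ = 1`, `m₄ = m`.
The eight unknowns are ordered as `x = (lam, mu, r₁₂, r₁₃, r₁₄, r₂₃, r₂₄, r₃₄)`. -/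

/-- The masses `(1, 1, 1, m)`. -/
def mass (m : ℝ) : Fin 4 → ℝ := ![1, 1, 1, m]

/-- The Newtonian potential `U = ∑_{i<j} mᵢ mⱼ / rᵢⱼ`. -/
def potential (x : Fin 8 → ℝ) (m : ℝ) : ℝ :=
  1 / x 2 + 1 / x 3 + m / x 4 + 1 / x 5 + m / x 6 + m / x 7

/-- `∑_{i<j} mᵢ mⱼ rᵢⱼ²`, which is the total mass `M = 3 + m` times the moment of inertia. -/
def weightedSquares (x : Fin 8 → ℝ) (m : ℝ) : ℝ :=
  x 2 ^ 2 + x 3 ^ 2 + m * x 4 ^ 2 + x 5 ^ 2 + m * x 6 ^ 2 + m * x 7 ^ 2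

/-- The moment of inertia `I = (1 / M) ∑_{i<j} mᵢ mⱼ rᵢⱼ²`. -/
def inertia (x : Fin 8 → ℝ) (m : ℝ) : ℝ := weightedSquares x m / (3 + m)

/-- The Cayley-Menger determinant `S` of the six mutual distances. -/
def cayleyMenger (x : Fin 8 → ℝ) : ℝ :=
  Matrix.det !![0, 1, 1, 1, 1;
                1, 0, x 2 ^ 2, x 3 ^ 2, x 4 ^ 2;
                1, x 2 ^ 2, 0, x 5 ^ 2, x 6 ^ 2;
                1, x 3 ^ 2, x 5 ^ 2, 0, x 7 ^ 2;
                1, x 4 ^ 2, x 6 ^ 2, x 7 ^ 2, 0]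

/-- Dziobek's function `V = U + lam (I - 1) + mu S`, with both multipliers among the variables. -/
def lagrangian (x : Fin 8 → ℝ) (m : ℝ) : ℝ :=
  potential x m + x 0 * (inertia x m - 1) + x 1 * cayleyMenger x

/-- `sPartial a b c d e f` is `(1 / 2) ∂S / ∂(r_ij²)`, where `a = r_ij²`, `f = r_kl²` is the
opposite edge, `b = r_ik²`, `c = r_il²`, `d = r_jk²`, `e = r_jl²`. -/
def sPartial (a b c d e f : ℝ) : ℝ := f * (b + c + d + e - 2 * a - f) - (b - c) * (d - e)

/-- The Dziobek map `F = (F₁, …, F₈)`: the eight partial derivatives of `lagrangian`, in the order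
of the variables, with the denominators cleared, i.e. multiplied by `M = 3 + m` (first component),
`1` (second component) and `M rᵢⱼ²` (the components belonging to `rᵢⱼ`);
see `dziobek_eq_clearing_mul_deriv`. -/
def dziobek (x : Fin 8 → ℝ) (m : ℝ) : Fin 8 → ℝ :=
  ![weightedSquares x m - (3 + m),
    cayleyMenger x,
    -(3 + m) + 2 * x 0 * x 2 ^ 3 + 4 * (3 + m) * x 1 * x 2 ^ 3 *
      sPartial (x 2 ^ 2) (x 3 ^ 2) (x 4 ^ 2) (x 5 ^ 2) (x 6 ^ 2) (x 7 ^ 2),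
    -(3 + m) + 2 * x 0 * x 3 ^ 3 + 4 * (3 + m) * x 1 * x 3 ^ 3 *
      sPartial (x 3 ^ 2) (x 2 ^ 2) (x 4 ^ 2) (x 5 ^ 2) (x 7 ^ 2) (x 6 ^ 2),
    -(3 + m) * m + 2 * x 0 * m * x 4 ^ 3 + 4 * (3 + m) * x 1 * x 4 ^ 3 *
      sPartial (x 4 ^ 2) (x 2 ^ 2) (x 3 ^ 2) (x 6 ^ 2) (x 7 ^ 2) (x 5 ^ 2),
    -(3 + m) + 2 * x 0 * x 5 ^ 3 + 4 * (3 + m) * x 1 * x 5 ^ 3 *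
      sPartial (x 5 ^ 2) (x 2 ^ 2) (x 6 ^ 2) (x 3 ^ 2) (x 7 ^ 2) (x 4 ^ 2),
    -(3 + m) * m + 2 * x 0 * m * x 6 ^ 3 + 4 * (3 + m) * x 1 * x 6 ^ 3 *
      sPartial (x 6 ^ 2) (x 2 ^ 2) (x 5 ^ 2) (x 4 ^ 2) (x 7 ^ 2) (x 3 ^ 2),
    -(3 + m) * m + 2 * x 0 * m * x 7 ^ 3 + 4 * (3 + m) * x 1 * x 7 ^ 3 *
      sPartial (x 7 ^ 2) (x 3 ^ 2) (x 5 ^ 2) (x 4 ^ 2) (x 6 ^ 2) (x 2 ^ 2)]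

/-- The factors that clear the denominators of the partial derivatives of `lagrangian`. -/
def clearing (x : Fin 8 → ℝ) (m : ℝ) : Fin 8 → ℝ :=
  ![3 + m, 1, (3 + m) * x 2 ^ 2, (3 + m) * x 3 ^ 2, (3 + m) * x 4 ^ 2,
    (3 + m) * x 5 ^ 2, (3 + m) * x 6 ^ 2, (3 + m) * x 7 ^ 2]

theorem cayleyMenger_eq (x : Fin 8 → ℝ) :
    cayleyMenger x =
      2 * (x 2 ^ 2 * x 7 ^ 2 * (x 3 ^ 2 + x 4 ^ 2 + x 5 ^ 2 + x 6 ^ 2 - x 2 ^ 2 - x 7 ^ 2)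
        + x 3 ^ 2 * x 6 ^ 2 * (x 2 ^ 2 + x 4 ^ 2 + x 5 ^ 2 + x 7 ^ 2 - x 3 ^ 2 - x 6 ^ 2)
        + x 4 ^ 2 * x 5 ^ 2 * (x 2 ^ 2 + x 3 ^ 2 + x 6 ^ 2 + x 7 ^ 2 - x 4 ^ 2 - x 5 ^ 2)
        - x 2 ^ 2 * x 3 ^ 2 * x 5 ^ 2 - x 2 ^ 2 * x 4 ^ 2 * x 6 ^ 2
        - x 3 ^ 2 * x 4 ^ 2 * x 7 ^ 2 - x 5 ^ 2 * x 6 ^ 2 * x 7 ^ 2) := by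
  unfold cayleyMenger
  simp [Matrix.det_succ_row_zero, Fin.sum_univ_succ, Fin.succAbove]
  ring

theorem deriv_aux (c₀ c₁ c₂ c₃ t : ℝ) (ht : t ≠ 0) :
    deriv (fun t => c₀ + c₁ / t + c₂ * t ^ 2 + c₃ * t ^ 4) t =
      -c₁ / t ^ 2 + 2 * c₂ * t + 4 * c₃ * t ^ 3 := by
  have h := ((((hasDerivAt_id t).inv ht).const_mul c₁).const_add c₀).add
    (((hasDerivAt_pow 2 t).const_mul c₂).add ((hasDerivAt_pow 4 t).const_mul c₃))
  convert h.deriv using 1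
  · congr 1
    funext s
    simp [div_eq_mul_inv]
    ring
  · simp
    ring

theorem dziobek_eq_clearing_mul_deriv (x : Fin 8 → ℝ) (m : ℝ) (hm : 3 + m ≠ 0)
    (hx : ∀ k, 2 ≤ k → x k ≠ 0) (k : Fin 8) :
    dziobek x m k =
      clearing x m k * deriv (fun t => lagrangian (Function.update x k t) m) (x k) := by
  have key : ∀ (k : Fin 8) (c₁ c₂ c₃ : ℝ), 2 ≤ k →
      (∀ t, lagrangian (Function.update x k t) m =
        lagrangian (Function.update x k 0) m + c₁ / t + c₂ * t ^ 2 + c₃ * t ^ 4) →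
      deriv (fun t => lagrangian (Function.update x k t) m) (x k) =
        -c₁ / x k ^ 2 + 2 * c₂ * x k + 4 * c₃ * x k ^ 3 := by
    intro k c₁ c₂ c₃ hk h
    rw [funext h]
    exact deriv_aux _ _ _ _ _ (hx k hk)
  fin_cases k
  · have h : (fun t => lagrangian (Function.update x 0 t) m) =
        fun t => potential x m + t * (inertia x m - 1) + x 1 * cayleyMenger x := by
      funext t
      simp [lagrangian, potential, inertia, weightedSquares, cayleyMenger]
    simp only [Fin.mk_zero, h]
    simp [dziobek, clearing, inertia]
    field_simp
  · have h : (fun t => lagrangian (Function.update x 1 t) m) =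
        fun t => potential x m + x 0 * (inertia x m - 1) + t * cayleyMenger x := by
      funext t
      simp [lagrangian, potential, inertia, weightedSquares, cayleyMenger]
    simp only [Fin.mk_one, h]
    simp [dziobek, clearing]
  · have hk := hx 2 (by decide)
    have h := key 2 1 (x 0 * 1 / (3 + m) + 2 * x 1 * sPartial 0 (x 3 ^ 2) (x 4 ^ 2) (x 5 ^ 2) (x 6 ^ 2) (x 7 ^ 2))
      (-2 * x 1 * x 7 ^ 2) (by decide) (by
        intro t
        simp [lagrangian, potential, inertia, weightedSquares, cayleyMenger_eq, sPartial]
        ring)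
    simp only [Fin.reduceFinMk, h]
    simp [dziobek, clearing, sPartial]
    field_simp
    ring
  · have hk := hx 3 (by decide)
    have h := key 3 1 (x 0 * 1 / (3 + m) + 2 * x 1 * sPartial 0 (x 2 ^ 2) (x 4 ^ 2) (x 5 ^ 2) (x 7 ^ 2) (x 6 ^ 2))
      (-2 * x 1 * x 6 ^ 2) (by decide) (by
        intro t
        simp [lagrangian, potential, inertia, weightedSquares, cayleyMenger_eq, sPartial]
        ring)
    simp only [Fin.reduceFinMk, h]
    simp [dziobek, clearing, sPartial]
    field_simp
    ring
  · have hk := hx 4 (by decide)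
    have h := key 4 m (x 0 * m / (3 + m) + 2 * x 1 * sPartial 0 (x 2 ^ 2) (x 3 ^ 2) (x 6 ^ 2) (x 7 ^ 2) (x 5 ^ 2))
      (-2 * x 1 * x 5 ^ 2) (by decide) (by
        intro t
        simp [lagrangian, potential, inertia, weightedSquares, cayleyMenger_eq, sPartial]
        ring)
    simp only [Fin.reduceFinMk, h]
    simp [dziobek, clearing, sPartial]
    field_simp
    ring
  · have hk := hx 5 (by decide)
    have h := key 5 1 (x 0 * 1 / (3 + m) + 2 * x 1 * sPartial 0 (x 2 ^ 2) (x 6 ^ 2) (x 3 ^ 2) (x 7 ^ 2) (x 4 ^ 2))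
      (-2 * x 1 * x 4 ^ 2) (by decide) (by
        intro t
        simp [lagrangian, potential, inertia, weightedSquares, cayleyMenger_eq, sPartial]
        ring)
    simp only [Fin.reduceFinMk, h]
    simp [dziobek, clearing, sPartial]
    field_simp
    ring
  · have hk := hx 6 (by decide)
    have h := key 6 m (x 0 * m / (3 + m) + 2 * x 1 * sPartial 0 (x 2 ^ 2) (x 5 ^ 2) (x 4 ^ 2) (x 7 ^ 2) (x 3 ^ 2))
      (-2 * x 1 * x 3 ^ 2) (by decide) (by
        intro t
        simp [lagrangian, potential, inertia, weightedSquares, cayleyMenger_eq, sPartial]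
        ring)
    simp only [Fin.reduceFinMk, h]
    simp [dziobek, clearing, sPartial]
    field_simp
    ring
  · have hk := hx 7 (by decide)
    have h := key 7 m (x 0 * m / (3 + m) + 2 * x 1 * sPartial 0 (x 3 ^ 2) (x 5 ^ 2) (x 4 ^ 2) (x 6 ^ 2) (x 2 ^ 2))
      (-2 * x 1 * x 2 ^ 2) (by decide) (by
        intro t
        simp [lagrangian, potential, inertia, weightedSquares, cayleyMenger_eq, sPartial]
        ring)
    simp only [Fin.reduceFinMk, h]
    simp [dziobek, clearing, sPartial]
    field_simp
    ring

/-- The Jacobian matrix `DF` of `F(·, m)` at `x`. -/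
def jacobian (F : (Fin 8 → ℝ) → ℝ → Fin 8 → ℝ) (x : Fin 8 → ℝ) (m : ℝ) :
    Matrix (Fin 8) (Fin 8) ℝ :=
  LinearMap.toMatrix' (fderiv ℝ (fun y => F y m) x : (Fin 8 → ℝ) →ₗ[ℝ] Fin 8 → ℝ)

/-- The closed interval with centre `c` and radius `10 ^ (-k)`. -/
def decimalInterval (c : ℝ) (k : ℕ) : Set ℝ := Set.Icc (c - 1 / 10 ^ k) (c + 1 / 10 ^ k)

/-- The box of the variables `(lam, mu, r₁₂, r₁₃, r₁₄, r₂₃, r₂₄, r₃₄)`. -/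
def xBox : Set (Fin 8 → ℝ) :=
  {x | x 0 ∈ decimalInterval 4.10486749931246396567394557 26 ∧
    x 1 ∈ decimalInterval 0.7904883951465367 16 ∧
    x 2 ∈ decimalInterval 0.98742601345654 14 ∧
    x 3 ∈ decimalInterval 0.57921860462471 14 ∧
    x 4 ∈ decimalInterval 1.00549177029900 14 ∧
    x 5 ∈ decimalInterval 0.57921860462471 14 ∧
    x 6 ∈ decimalInterval 1.00549177029900 14 ∧
    x 7 ∈ decimalInterval 0.57304559793134 14}

/-- The interval of the mass parameter. -/
def mBox : Set ℝ := decimalInterval 1.00266054757261000068580350 26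

/-- Enclosure of the right null vector, normalized to have last component `1`. -/
def vBox : Set (Fin 8 → ℝ) :=
  {v | v 0 ∈ decimalInterval 0 9 ∧
    v 1 ∈ decimalInterval (-0.179026448) 9 ∧
    v 2 ∈ decimalInterval 2.989514215 9 ∧
    v 3 ∈ decimalInterval (-0.5496816801) 10 ∧
    v 4 ∈ decimalInterval (-1.4331568126) 10 ∧
    v 5 ∈ decimalInterval (-0.5496816801) 10 ∧
    v 6 ∈ decimalInterval (-1.4331568126) 10 ∧
    v 7 = 1}

/-- Enclosure of the left null vector, normalized to have last component `1`. -/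
def wBox : Set (Fin 8 → ℝ) :=
  {w | w 0 ∈ decimalInterval 0 9 ∧
    w 1 ∈ decimalInterval (-0.235312131) 9 ∧
    w 2 ∈ decimalInterval 1.0068617795 10 ∧
    w 3 ∈ decimalInterval (-0.5380276784) 10 ∧
    w 4 ∈ decimalInterval (-0.46549501352) 11 ∧
    w 5 ∈ decimalInterval (-0.5380276784) 10 ∧
    w 6 ∈ decimalInterval (-0.46549501352) 11 ∧
    w 7 = 1}

/-- The action on `ℝ⁸` of the exchange of the bodies `1` and `2`:
`(lam, mu, r₁₂, r₁₃, r₁₄, r₂₃, r₂₄, r₃₄) ↦ (lam, mu, r₁₂, r₂₃, r₂₄, r₁₃, r₁₄, r₃₄)`. -/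
def swap12 (x : Fin 8 → ℝ) : Fin 8 → ℝ := ![x 0, x 1, x 2, x 5, x 6, x 3, x 4, x 7]

/-- The last six entries of `x` are the mutual distances of the points `q`. -/
def HasMutualDistances (q : Fin 4 → EuclideanSpace ℝ (Fin 2)) (x : Fin 8 → ℝ) : Prop :=
  dist (q 0) (q 1) = x 2 ∧ dist (q 0) (q 2) = x 3 ∧ dist (q 0) (q 3) = x 4 ∧
    dist (q 1) (q 2) = x 5 ∧ dist (q 1) (q 3) = x 6 ∧ dist (q 2) (q 3) = x 7

/-- The centre of mass. -/
def centerOfMass {n d : ℕ} (μ : Fin n → ℝ) (q : Fin n → EuclideanSpace ℝ (Fin d)) :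
    EuclideanSpace ℝ (Fin d) :=
  (∑ i, μ i)⁻¹ • ∑ i, μ i • q i

/-- Central configurations of `n` distinct points with masses `μ`:
`lam (q_j - q_G) = ∑_{i ≠ j} m_i (q_i - q_j) / r_ij³` for all `j`, with one constant `lam`. -/
def IsCentralConfiguration {n d : ℕ} (μ : Fin n → ℝ) (q : Fin n → EuclideanSpace ℝ (Fin d)) :
    Prop :=
  Function.Injective q ∧ ∃ lam : ℝ, ∀ j, lam • (q j - centerOfMass μ q) =
    ∑ i ∈ Finset.univ.erase j, (μ i / dist (q i) (q j) ^ 3) • (q i - q j)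

/-- The one-parameter family of equations `F(x, μ) = 0` has a fold (saddle-node) bifurcation at
`(x₀, μ₀)`, with the solutions on the side `μ > μ₀` if `0 < σ` and on the side `μ < μ₀` if `σ < 0`.

First part: near `(x₀, μ₀)` the zero set of `F` is a regular smooth curve `s ↦ (γ s, μ s)` through
`(x₀, μ₀)` that has a quadratic turning point with respect to the parameter there.
Second part: in arbitrarily small neighbourhoods `U` of `x₀` there are, for all `μ` close to `μ₀`,
exactly two solutions on one side of `μ₀`, only `x₀` for `μ = μ₀`, and none on the other side. -/
def IsFoldBifurcation {E : Type*} [NormedAddCommGroup E] [NormedSpace ℝ E]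
    (F : E → ℝ → E) (x₀ : E) (μ₀ σ : ℝ) : Prop :=
  (∃ (γ : ℝ → E) (μ : ℝ → ℝ) (δ : ℝ), 0 < δ ∧
      ContDiffOn ℝ ∞ γ (Set.Ioo (-δ) δ) ∧ ContDiffOn ℝ ∞ μ (Set.Ioo (-δ) δ) ∧
      Set.InjOn γ (Set.Ioo (-δ) δ) ∧ γ 0 = x₀ ∧ μ 0 = μ₀ ∧
      deriv γ 0 ≠ 0 ∧ deriv μ 0 = 0 ∧ 0 < σ * deriv (deriv μ) 0 ∧
      ∃ N ∈ 𝓝 (x₀, μ₀),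
        {p : E × ℝ | p ∈ N ∧ F p.1 p.2 = 0} = (fun s => (γ s, μ s)) '' Set.Ioo (-δ) δ) ∧
  ∀ W ∈ 𝓝 x₀, ∃ U ∈ 𝓝 x₀, U ⊆ W ∧ ∃ ε > 0, ∀ μ : ℝ, |μ - μ₀| < ε →
    (0 < σ * (μ - μ₀) → {x | x ∈ U ∧ F x μ = 0}.ncard = 2) ∧
    (μ = μ₀ → {x | x ∈ U ∧ F x μ = 0} = {x₀}) ∧
    (σ * (μ - μ₀) < 0 → {x | x ∈ U ∧ F x μ = 0} = ∅)

end FourBody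

end

open FourBody

/-!
A singular zero of the Dziobek map `F`, together with a normalised null vector `v` of `DF`, is a
zero of the square system `F = 0`, `DF v = 0`, `v 7 = 1` in the unknowns `(x, m, v)`. The matrix
obtained from `DF` by replacing one row by `v ↦ v 7` is invertible on the whole box. Hence the
kernel of `DF` is at most a line, and every null vector can be normalised and enclosed. The system
is regular at a fold, so on the resulting enclosure of all singular zeros the Newton map with a
fixed approximate inverse is a contraction, which gives uniqueness; that it maps a tiny ball to
itself gives existence and tight bounds for all components. Both are certified in integer interval
arithmetic.

The system is invariant under exchanging the bodies `q₁` and `q₂`, so by uniqueness the solution is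
symmetric: it is a kite, which is realised in the plane because the Cayley–Menger determinant
vanishes. In the plane `∂S/∂rᵢⱼ²` is a multiple of `Δᵢ Δⱼ` with `Δ` the signed areas of the four
triangles, so Dziobek's equations give `mᵢ mⱼ (rᵢⱼ⁻³ - a) = b Δᵢ Δⱼ`. As `Δ` is an affine dependence
of the `qᵢ`, the right-hand side does not contribute to the accelerations and the configuration is
central.

The fold follows from the inverse function theorem: as `w ⬝ F_m ≠ 0`, the map
`(x, m) ↦ (F(x, m), x₇ - x₇*)` is a local diffeomorphism at the solution, so the zero set of `F` is
a curve parametrised by `x₇`, and differentiating `w ⬝ F = 0` twice along it expresses the second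
derivative of the mass through `w ⬝ D²F(v, v)` and `w ⬝ F_m`.
-/

namespace FourBody

/-! ### Interval arithmetic -/

/-- Polynomial expressions with integer coefficients in variables indexed by `ι`. In contrast to
`MvPolynomial` they can be evaluated by the kernel, in particular in interval arithmetic. -/
inductive PolyExpr (ι : Type*)
  | const (c : ℤ)
  | var (i : ι)
  | add (a b : PolyExpr ι)
  | mul (a b : PolyExpr ι)
  | pow (a : PolyExpr ι) (k : ℕ)

namespace PolyExpr

variable {ι : Type*}

instance : IntCast (PolyExpr ι) := ⟨const⟩
instance : Zero (PolyExpr ι) := ⟨const 0⟩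
instance : One (PolyExpr ι) := ⟨const 1⟩
instance (n : ℕ) [n.AtLeastTwo] : OfNat (PolyExpr ι) n := ⟨const n⟩
instance : Add (PolyExpr ι) := ⟨add⟩
instance : Mul (PolyExpr ι) := ⟨mul⟩
instance : Neg (PolyExpr ι) := ⟨mul (const (-1))⟩
instance : Sub (PolyExpr ι) := ⟨fun a b => a + -b⟩
instance : Pow (PolyExpr ι) ℕ := ⟨pow⟩

/-- The value of an expression at a point whose coordinates may be numbers or intervals. -/
def eval {R : Type*} [IntCast R] [Add R] [Mul R] [Pow R ℕ] (z : ι → R) : PolyExpr ι → R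
  | const c => c
  | var i => z i
  | add a b => a.eval z + b.eval z
  | mul a b => a.eval z * b.eval z
  | pow a k => a.eval z ^ k

/-- The partial derivative with respect to the variable `j`. -/
def pderiv [DecidableEq ι] (j : ι) : PolyExpr ι → PolyExpr ι
  | const _ => 0
  | var i => if i = j then 1 else 0
  | add a b => a.pderiv j + b.pderiv j
  | mul a b => a.pderiv j * b + a * b.pderiv j
  | pow a k => const k * a ^ (k - 1) * a.pderiv j

section Ring

variable {R : Type*} [CommRing R] (z : ι → R)

@[simp] theorem eval_var (i : ι) : (var i).eval z = z i := rfl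

@[simp] theorem eval_zero : (0 : PolyExpr ι).eval z = 0 := Int.cast_zero

@[simp] theorem eval_one : (1 : PolyExpr ι).eval z = 1 := Int.cast_one

@[simp] theorem eval_ofNat (n : ℕ) [n.AtLeastTwo] :
    (ofNat(n) : PolyExpr ι).eval z = ofNat(n) :=
  Int.cast_natCast n

@[simp] theorem eval_add (a b : PolyExpr ι) : (a + b).eval z = a.eval z + b.eval z := rfl

@[simp] theorem eval_mul (a b : PolyExpr ι) : (a * b).eval z = a.eval z * b.eval z := rfl

@[simp] theorem eval_pow (a : PolyExpr ι) (k : ℕ) : (a ^ k).eval z = a.eval z ^ k := rfl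

@[simp] theorem eval_neg (a : PolyExpr ι) : (-a).eval z = -a.eval z := by
  change ((-1 : ℤ) : R) * a.eval z = _
  simp

@[simp] theorem eval_sub (a b : PolyExpr ι) : (a - b).eval z = a.eval z - b.eval z := by
  change a.eval z + (-b).eval z = _
  simp [sub_eq_add_neg]

theorem eval_list_sum (l : List (PolyExpr ι)) : l.sum.eval z = (l.map (eval z)).sum := by
  induction l with
  | nil => exact eval_zero z
  | cons a l ih => simp only [List.sum_cons, List.map_cons, eval_add, ih]

end Ring

theorem hasFDerivAt_eval [Fintype ι] [DecidableEq ι] (e : PolyExpr ι) (z : ι → ℝ) :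
    HasFDerivAt (fun y => e.eval y)
      (∑ j, (e.pderiv j).eval z • ContinuousLinearMap.proj (R := ℝ) (φ := fun _ => ℝ) j) z := by
  induction e with
  | const c =>
    refine (hasFDerivAt_const (c : ℝ) z).congr_fderiv ?_
    ext h
    simp [pderiv]
  | var i =>
    refine (hasFDerivAt_apply (𝕜 := ℝ) i z).congr_fderiv ?_
    ext h
    simp [pderiv, apply_ite (eval z)]
  | add a b iha ihb =>
    refine (iha.add ihb).congr_fderiv ?_
    ext h
    simp [pderiv, add_mul, Finset.sum_add_distrib]
  | mul a b iha ihb =>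
    refine (iha.mul ihb).congr_fderiv ?_
    ext h
    simp only [pderiv, eval_add, eval_mul, add_apply, smul_apply, sum_apply,
      ContinuousLinearMap.proj_apply, smul_eq_mul, Finset.mul_sum, ← Finset.sum_add_distrib]
    exact Finset.sum_congr rfl fun j _ => by ring
  | pow a k iha =>
    refine (iha.pow k).congr_fderiv ?_
    ext h
    have eval_factor : (const k * a ^ (k - 1)).eval z = k * a.eval z ^ (k - 1) := by
      simp [eval]
    simp [pderiv, Finset.mul_sum, eval_factor, mul_assoc]

theorem contDiff_eval [Fintype ι] (e : PolyExpr ι) {k : WithTop ℕ∞} :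
    ContDiff ℝ k (fun z : ι → ℝ => e.eval z) := by
  induction e with
  | const c => exact contDiff_const
  | var i => exact contDiff_apply ℝ ℝ i
  | add a b iha ihb => exact iha.add ihb
  | mul a b iha ihb => exact iha.mul ihb
  | pow a k iha => exact iha.pow k

theorem hasFDerivAt_eval_pi {ι κ : Type*} [Fintype ι] [DecidableEq ι] [Finite κ]
    (g : κ → PolyExpr ι) (z : ι → ℝ) :
    HasFDerivAt (fun y k => (g k).eval y)
      (Matrix.mulVecLin (.of fun k j => ((g k).pderiv j).eval z)).toContinuousLinearMap z := by
  refine hasFDerivAt_pi'.2 fun k => ((g k).hasFDerivAt_eval z).congr_fderiv ?_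
  ext h
  simp [Matrix.mulVec, dotProduct]

end PolyExpr

theorem abs_mul_sub_mul_le {x y a b r s : ℝ} (hx : |x - a| ≤ r) (hy : |y - b| ≤ s) :
    |x * y - a * b| ≤ |a| * s + |b| * r + r * s := by
  have hr : 0 ≤ r := (abs_nonneg _).trans hx
  calc |x * y - a * b| = |a * (y - b) + b * (x - a) + (x - a) * (y - b)| := by ring_nf
    _ ≤ |a * (y - b)| + |b * (x - a)| + |(x - a) * (y - b)| := abs_add_three _ _ _
    _ ≤ |a| * s + |b| * r + r * s := by
      simp only [abs_mul]
      gcongr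

theorem abs_div_sub_intCast_div_le (a : ℤ) (n : ℕ) :
    |(a : ℝ) / n - ((a / n : ℤ) : ℝ)| ≤ 1 := by
  have floor_eq := Int.floor_div_natCast (a : ℝ) n
  rw [Int.floor_intCast] at floor_eq
  rw [← floor_eq, Int.self_sub_floor, Int.abs_fract]
  exact (Int.fract_lt_one _).le

theorem div_le_natCast_div_add_one (a n : ℕ) : (a : ℝ) / n ≤ ((a / n : ℕ) : ℝ) + 1 := by
  rw [← Nat.floor_div_eq_div (K := ℝ)]
  exact (Nat.lt_floor_add_one _).le

/-- The compact interval with the given center and radius, both in units of `10⁻⁴⁰`. -/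
@[ext]
structure Ball where
  center : ℤ
  radius : ℕ

namespace Ball

/-- The number of units of interval arithmetic in `1`. -/
def scale : ℕ := 10 ^ 40

theorem scale_pos : (0 : ℝ) < scale := by norm_num [scale]

instance : Membership ℝ Ball := ⟨fun b x => |x * scale - b.center| ≤ b.radius⟩

theorem mem_def {x : ℝ} {b : Ball} : x ∈ b ↔ |x * scale - b.center| ≤ b.radius := Iff.rfl

instance : Zero Ball := ⟨⟨0, 0⟩⟩
instance : Add Ball := ⟨fun a b => ⟨a.center + b.center, a.radius + b.radius⟩⟩
instance : IntCast Ball := ⟨fun k => ⟨k * scale, 0⟩⟩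
instance : One Ball := ⟨(1 : ℤ)⟩
instance : Neg Ball := ⟨fun b => ⟨-b.center, b.radius⟩⟩
instance : Sub Ball := ⟨fun a b => a + -b⟩

/-- The center is rounded to an integer, which the radius makes up for. -/
instance : Mul Ball :=
  ⟨fun a b => ⟨a.center * b.center / scale,
    (a.center.natAbs * b.radius + b.center.natAbs * a.radius + a.radius * b.radius) / scale + 2⟩⟩

instance : Pow Ball ℕ := ⟨fun b k => npowRec k b⟩

instance : AddCommMonoid Ball where
  add_assoc a b c := Ball.ext (add_assoc ..) (add_assoc ..)
  zero_add a := Ball.ext (zero_add _) (zero_add _)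
  add_zero a := Ball.ext (add_zero _) (add_zero _)
  add_comm a b := Ball.ext (add_comm ..) (add_comm ..)
  nsmul := nsmulRec

theorem intCast_mem (k : ℤ) : (k : ℝ) ∈ (k : Ball) := by
  change |(k : ℝ) * scale - (k * scale : ℤ)| ≤ (0 : ℕ)
  simp

theorem zero_mem : (0 : ℝ) ∈ (0 : Ball) := by
  change |(0 : ℝ) * scale - (0 : ℤ)| ≤ (0 : ℕ)
  simp

theorem one_mem : (1 : ℝ) ∈ (1 : Ball) := by
  exact_mod_cast intCast_mem 1

theorem add_mem_add {x y : ℝ} {a b : Ball} (hx : x ∈ a) (hy : y ∈ b) : x + y ∈ a + b := by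
  change |(x + y) * scale - (a.center + b.center : ℤ)| ≤ (a.radius + b.radius : ℕ)
  push_cast
  calc |(x + y) * scale - (a.center + b.center)|
      = |(x * scale - a.center) + (y * scale - b.center)| := by ring_nf
    _ ≤ a.radius + b.radius := (abs_add_le _ _).trans (add_le_add hx hy)

theorem neg_mem_neg {x : ℝ} {b : Ball} (hx : x ∈ b) : -x ∈ -b := by
  change |-x * scale - (-b.center : ℤ)| ≤ b.radius
  rw [← abs_neg]
  convert mem_def.1 hx using 2
  push_cast
  ring

theorem sub_mem_sub {x y : ℝ} {a b : Ball} (hx : x ∈ a) (hy : y ∈ b) : x - y ∈ a - b := by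
  rw [sub_eq_add_neg]
  exact add_mem_add hx (neg_mem_neg hy)

theorem mul_mem_mul {x y : ℝ} {a b : Ball} (hx : x ∈ a) (hy : y ∈ b) : x * y ∈ a * b := by
  set R : ℕ := a.center.natAbs * b.radius + b.center.natAbs * a.radius + a.radius * b.radius
    with hR
  change |x * y * scale - (a.center * b.center / scale : ℤ)| ≤ (R / scale + 2 : ℕ)
  have exact_error : |x * scale * (y * scale) - (a.center * b.center : ℤ)| ≤ R := by
    simpa [hR, Nat.cast_natAbs] using abs_mul_sub_mul_le hx hy
  have scaled_error : |x * y * scale - (a.center * b.center : ℤ) / scale| ≤ R / scale := by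
    have hS := scale_pos
    rw [show x * y * scale = x * scale * (y * scale) / scale by field_simp, ← sub_div, abs_div,
      abs_of_pos hS]
    gcongr
  have rounding := abs_div_sub_intCast_div_le (a.center * b.center) scale
  have radius_le := div_le_natCast_div_add_one R scale
  rw [Nat.cast_add, Nat.cast_two]
  linarith [abs_sub_le (x * y * scale) ((a.center * b.center : ℤ) / scale)
    (a.center * b.center / scale : ℤ)]

theorem pow_mem_pow {x : ℝ} {b : Ball} (hx : x ∈ b) : ∀ k : ℕ, x ^ k ∈ b ^ k
  | 0 => by simpa only [pow_zero] using! one_mem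
  | k + 1 => mul_mem_mul (pow_mem_pow hx k) hx

theorem sum_mem_sum {ι : Type*} {s : Finset ι} {f : ι → ℝ} {b : ι → Ball}
    (h : ∀ i ∈ s, f i ∈ b i) : ∑ i ∈ s, f i ∈ ∑ i ∈ s, b i := by
  classical
  induction s using Finset.induction_on with
  | empty => simpa using zero_mem
  | insert i s hi ih =>
    rw [Finset.sum_insert hi, Finset.sum_insert hi]
    exact add_mem_add (h i (s.mem_insert_self i))
      (ih fun j hj => h j (Finset.mem_insert_of_mem hj))

theorem dotProduct_mem_dotProduct {ι : Type*} [Fintype ι] {x y : ι → ℝ} {a b : ι → Ball}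
    (hx : ∀ i, x i ∈ a i) (hy : ∀ i, y i ∈ b i) : x ⬝ᵥ y ∈ a ⬝ᵥ b :=
  sum_mem_sum fun i _ => mul_mem_mul (hx i) (hy i)

theorem eval_mem_eval {ι : Type*} {z : ι → ℝ} {b : ι → Ball} (h : ∀ i, z i ∈ b i)
    (e : PolyExpr ι) : e.eval z ∈ e.eval b := by
  induction e with
  | const c => exact intCast_mem c
  | var i => exact h i
  | add _ _ iha ihb => exact add_mem_add iha ihb
  | mul _ _ iha ihb => exact mul_mem_mul iha ihb
  | pow _ k iha => exact pow_mem_pow iha k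

/-- The largest absolute value in the interval, in units of `10⁻⁴⁰`. -/
def absBound (b : Ball) : ℕ := b.center.natAbs + b.radius

theorem abs_le_absBound {x : ℝ} {b : Ball} (hx : x ∈ b) : |x| ≤ b.absBound / scale := by
  rw [le_div_iff₀ scale_pos, ← abs_of_pos scale_pos, ← abs_mul]
  have := abs_sub_abs_le_abs_sub (x * scale) b.center
  have h := mem_def.1 hx
  simp only [absBound, Nat.cast_add, Nat.cast_natAbs, Int.cast_abs]
  linarith

/-- Inclusion of intervals, in a form that the kernel can decide. -/
instance : LE Ball := ⟨fun a b => (a.center - b.center).natAbs + a.radius ≤ b.radius⟩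

instance : DecidableLE Ball := fun a b =>
  inferInstanceAs (Decidable ((a.center - b.center).natAbs + a.radius ≤ b.radius))

theorem mem_of_le {x : ℝ} {a b : Ball} (hab : a ≤ b) (hx : x ∈ a) : x ∈ b := by
  have h : ((a.center - b.center).natAbs + a.radius : ℝ) ≤ b.radius := by exact_mod_cast hab
  rw [Nat.cast_natAbs, Int.cast_abs, Int.cast_sub] at h
  rw [mem_def] at *
  linarith [abs_sub_le (x * scale) a.center b.center]

/-- The midpoint of the interval. -/
noncomputable def mid (b : Ball) : ℝ := b.center / scale

theorem mem_iff_abs_sub_mid_le {x : ℝ} {b : Ball} : x ∈ b ↔ |x - b.mid| ≤ b.radius / scale := by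
  have hS := scale_pos
  rw [mem_def, le_div_iff₀ hS, ← abs_of_pos hS, ← abs_mul, sub_mul, abs_of_pos hS, mid,
    div_mul_cancel₀ _ hS.ne']

theorem mid_mem (b : Ball) : b.mid ∈ b := by
  rw [mem_iff_abs_sub_mid_le, sub_self, abs_zero]
  have hS := scale_pos
  positivity

theorem convex_setOf_forall_mem {ι : Type*} (b : ι → Ball) :
    Convex ℝ {z : ι → ℝ | ∀ i, z i ∈ b i} := by
  simp only [mem_iff_abs_sub_mid_le, ← Real.dist_eq, ← Metric.mem_closedBall, Set.ofPred_forall]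
  exact convex_iInter fun i =>
    (convex_closedBall _ _).is_linear_preimage (LinearMap.proj (R := ℝ) i).isLinear

/-- The interval of radius `r` around `c / 10 ^ k`; the encoding is exact for `k ≤ 40`. -/
def around (c : ℤ) (k r : ℕ) : Ball := ⟨c * 10 ^ (40 - k), r⟩

theorem mid_around {c : ℤ} {k r : ℕ} (hk : k ≤ 40) : (around c k r).mid = c / 10 ^ k := by
  have hS : (scale : ℝ) = 10 ^ (40 - k) * 10 ^ k := by
    rw [← pow_add, Nat.sub_add_cancel hk]
    norm_num [scale]
  rw [mid, around, hS]
  push_cast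
  field_simp

/-- The numbers that differ from `c / 10 ^ k` by at most one unit in the `k`-th decimal. -/
def lastDigit (c : ℤ) (k : ℕ) : Ball := around c k (10 ^ (40 - k))

theorem mem_lastDigit_iff {x : ℝ} {c : ℤ} {k : ℕ} (hk : k ≤ 40) :
    x ∈ lastDigit c k ↔ x ∈ decimalInterval (c / 10 ^ k) k := by
  have hs : ((10 ^ (40 - k) : ℕ) : ℝ) / scale = 1 / 10 ^ k := by
    rw [div_eq_div_iff scale_pos.ne' (by positivity), one_mul, scale]
    norm_cast
    rw [← pow_add, Nat.sub_add_cancel hk]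
  rw [lastDigit, mem_iff_abs_sub_mid_le, mid_around hk, around, hs, decimalInterval, Set.mem_Icc,
    abs_le]
  constructor <;> rintro ⟨h₁, h₂⟩ <;> constructor <;> linarith

end Ball

/-! ### Approximate inverses -/

section Newton

variable {E F : Type*} [NormedAddCommGroup E] [NormedSpace ℝ E] [NormedAddCommGroup F]
  [NormedSpace ℝ F] {f : E → F} {f' : E → E →L[ℝ] F} {A : F →L[ℝ] E} {s : Set E} {c : NNReal}

theorem approximatesLinearOn_comp_of_norm_comp_sub_id_le (hs : Convex ℝ s)
    (hf : ∀ z ∈ s, HasFDerivWithinAt f (f' z) s z)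
    (hA : ∀ z ∈ s, ‖A ∘L f' z - .id ℝ E‖ ≤ c) :
    ApproximatesLinearOn (A ∘ f) (.id ℝ E) s c :=
  fun _ hx _ hy => hs.norm_image_sub_le_of_norm_hasFDerivWithin_le'
    (fun z hz => A.hasFDerivAt.comp_hasFDerivWithinAt z (hf z hz)) hA hy hx

theorem injOn_of_norm_comp_sub_id_le (hs : Convex ℝ s)
    (hf : ∀ z ∈ s, HasFDerivWithinAt f (f' z) s z) (hc : c < 1)
    (hA : ∀ z ∈ s, ‖A ∘L f' z - .id ℝ E‖ ≤ c) : Set.InjOn f s := by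
  intro x hx y hy hxy
  have dist_le := approximatesLinearOn_comp_of_norm_comp_sub_id_le hs hf hA x hx y hy
  simp only [Function.comp_apply, hxy, sub_self, zero_sub, norm_neg,
    ContinuousLinearMap.id_apply] at dist_le
  by_contra hne
  have hpos : 0 < ‖x - y‖ := norm_pos_iff.2 (sub_ne_zero.2 hne)
  exact dist_le.not_gt (mul_lt_of_lt_one_left hpos (by exact_mod_cast hc))

/-- The Newton-like iteration `z ↦ z - A (f z)` is a contraction of the ball. -/
theorem exists_zero_mem_closedBall_of_norm_comp_sub_id_le [CompleteSpace E] {a : E} {r : ℝ}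
    (hr : 0 ≤ r) (hf : ∀ z ∈ Metric.closedBall a r, HasFDerivAt f (f' z) z)
    (hA : ∀ z ∈ Metric.closedBall a r, ‖A ∘L f' z - .id ℝ E‖ ≤ c)
    (hA_inj : Function.Injective A) (ha : ‖A (f a)‖ ≤ (1 - c) * r) :
    ∃ z ∈ Metric.closedBall a r, f z = 0 := by
  have approx := approximatesLinearOn_comp_of_norm_comp_sub_id_le (convex_closedBall a r)
    (fun z hz => (hf z hz).hasFDerivWithinAt) hA
  have surj := approx.surjOn_closedBall_of_nonlinearRightInverse
    ⟨id, 1, by simp, fun _ => rfl⟩ hr subset_rfl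
  obtain ⟨z, hz, hz₀⟩ := surj (show 0 ∈ Metric.closedBall _ _ by simpa [dist_eq_norm] using ha)
  exact ⟨z, hz, hA_inj (hz₀.trans (map_zero A).symm)⟩

end Newton

section ApproximateInverse

open Matrix
open scoped Matrix.Norms.Operator

variable {n : Type*} [Fintype n] [DecidableEq n] {A M B : Matrix n n ℝ}

theorem norm_le_two_mul_norm_mulVec (hB : ‖1 - B‖ ≤ 1 / 2) (u : n → ℝ) : ‖u‖ ≤ 2 * ‖B *ᵥ u‖ := by
  have h : ‖u - B *ᵥ u‖ ≤ 1 / 2 * ‖u‖ := by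
    calc ‖u - B *ᵥ u‖ = ‖(1 - B) *ᵥ u‖ := by rw [sub_mulVec, one_mulVec]
      _ ≤ ‖1 - B‖ * ‖u‖ := linfty_opNorm_mulVec _ _
      _ ≤ 1 / 2 * ‖u‖ := by gcongr
  linarith [norm_sub_norm_le u (B *ᵥ u)]

theorem det_ne_zero_of_norm_one_sub_le (hB : ‖1 - B‖ ≤ 1 / 2) : B.det ≠ 0 := by
  intro hdet
  obtain ⟨u, hu, hBu⟩ := exists_mulVec_eq_zero_iff.2 hdet
  have h := norm_le_two_mul_norm_mulVec hB u
  rw [hBu, norm_zero, mul_zero] at h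
  exact hu (norm_le_zero_iff.1 h)

theorem norm_sub_le_of_mulVec_eq {g u : n → ℝ} (hAM : ‖1 - A * M‖ ≤ 1 / 2) (hu : M *ᵥ u = g)
    (c : n → ℝ) : ‖u - c‖ ≤ 2 * ‖A *ᵥ (g - M *ᵥ c)‖ := by
  have h := norm_le_two_mul_norm_mulVec hAM (u - c)
  rwa [← mulVec_mulVec, mulVec_sub, hu] at h

end ApproximateInverse

section NullVector

open Matrix

variable {n K : Type*} [Fintype n] [DecidableEq n] [Field K] {J : Matrix n n K} {k l : n}

theorem updateRow_single_mulVec {u : n → K} (hu : J *ᵥ u = 0) :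
    J.updateRow k (Pi.single l 1) *ᵥ u = Pi.single k (u l) := by
  ext i
  rcases eq_or_ne i k with rfl | hik
  · simp [mulVec]
  · simpa [mulVec, hik] using congrFun hu i

theorem eq_smul_of_mulVec_eq_zero (hB : (J.updateRow k (Pi.single l 1)).det ≠ 0) {u v : n → K}
    (hu : J *ᵥ u = 0) (hv : J *ᵥ v = 0) (hvl : v l = 1) : u = u l • v := by
  have h : J *ᵥ (u - u l • v) = 0 := by rw [mulVec_sub, mulVec_smul, hu, hv, smul_zero, sub_zero]
  refine sub_eq_zero.1 (eq_zero_of_mulVec_eq_zero hB ?_)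
  rw [updateRow_single_mulVec h]
  simp [hvl]

theorem exists_mulVec_eq_zero_apply_eq_one (hJ : J.det = 0)
    (hB : (J.updateRow k (Pi.single l 1)).det ≠ 0) : ∃ v, J *ᵥ v = 0 ∧ v l = 1 := by
  obtain ⟨u, hu₀, hu⟩ := exists_mulVec_eq_zero_iff.2 hJ
  have hul : u l ≠ 0 := by
    intro hul
    refine hu₀ (eq_zero_of_mulVec_eq_zero hB ?_)
    rw [updateRow_single_mulVec hu, hul, Pi.single_zero]
  exact ⟨(u l)⁻¹ • u, by rw [mulVec_smul, hu, smul_zero], by simp [hul]⟩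

theorem finrank_ker_mulVecLin_eq_one (hB : (J.updateRow k (Pi.single l 1)).det ≠ 0) {v : n → K}
    (hv : J *ᵥ v = 0) (hvl : v l = 1) : Module.finrank K (LinearMap.ker J.mulVecLin) = 1 := by
  have hv₀ : v ≠ 0 := by
    rintro rfl
    exact zero_ne_one hvl
  have ker_eq : LinearMap.ker J.mulVecLin = Submodule.span K {v} := by
    ext u
    rw [Submodule.mem_span_singleton, LinearMap.mem_ker, mulVecLin_apply]
    constructor
    · exact fun hu => ⟨u l, (eq_smul_of_mulVec_eq_zero hB hu hv hvl).symm⟩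
    · rintro ⟨a, rfl⟩
      rw [mulVec_smul, hv, smul_zero]
  rw [ker_eq, finrank_span_singleton hv₀]

end NullVector

/-! ### The Dziobek map as a family of polynomial expressions -/

/-- The variables of the system for singular zeros: the eight unknowns `x`, the mass `m` and the
components of a null vector `v`. -/
abbrev Var := Fin 8 ⊕ Unit ⊕ Fin 8

/-- The family indexed by `Var` that consists of `x`, `m` and `v`. -/
def joint {R : Type*} (x : Fin 8 → R) (m : R) (v : Fin 8 → R) : Var → R :=
  Sum.elim x (Sum.elim (fun _ => m) v)

namespace PolyExpr

/-- The counterpart of `sPartial`. -/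
def sPartialExpr (a b c d e f : PolyExpr Var) : PolyExpr Var :=
  f * (b + c + d + e - 2 * a - f) - (b - c) * (d - e)

/-- The components of the Dziobek map. -/
def dziobekExpr : Fin 8 → PolyExpr Var :=
  let x (i : Fin 8) : PolyExpr Var := var (.inl i)
  let m : PolyExpr Var := var (.inr (.inl ()))
  ![x 2 ^ 2 + x 3 ^ 2 + m * x 4 ^ 2 + x 5 ^ 2 + m * x 6 ^ 2 + m * x 7 ^ 2 - (3 + m),
    2 * (x 2 ^ 2 * x 7 ^ 2 * (x 3 ^ 2 + x 4 ^ 2 + x 5 ^ 2 + x 6 ^ 2 - x 2 ^ 2 - x 7 ^ 2)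
      + x 3 ^ 2 * x 6 ^ 2 * (x 2 ^ 2 + x 4 ^ 2 + x 5 ^ 2 + x 7 ^ 2 - x 3 ^ 2 - x 6 ^ 2)
      + x 4 ^ 2 * x 5 ^ 2 * (x 2 ^ 2 + x 3 ^ 2 + x 6 ^ 2 + x 7 ^ 2 - x 4 ^ 2 - x 5 ^ 2)
      - x 2 ^ 2 * x 3 ^ 2 * x 5 ^ 2 - x 2 ^ 2 * x 4 ^ 2 * x 6 ^ 2
      - x 3 ^ 2 * x 4 ^ 2 * x 7 ^ 2 - x 5 ^ 2 * x 6 ^ 2 * x 7 ^ 2),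
    -(3 + m) + 2 * x 0 * x 2 ^ 3 + 4 * (3 + m) * x 1 * x 2 ^ 3 *
      sPartialExpr (x 2 ^ 2) (x 3 ^ 2) (x 4 ^ 2) (x 5 ^ 2) (x 6 ^ 2) (x 7 ^ 2),
    -(3 + m) + 2 * x 0 * x 3 ^ 3 + 4 * (3 + m) * x 1 * x 3 ^ 3 *
      sPartialExpr (x 3 ^ 2) (x 2 ^ 2) (x 4 ^ 2) (x 5 ^ 2) (x 7 ^ 2) (x 6 ^ 2),
    -(3 + m) * m + 2 * x 0 * m * x 4 ^ 3 + 4 * (3 + m) * x 1 * x 4 ^ 3 *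
      sPartialExpr (x 4 ^ 2) (x 2 ^ 2) (x 3 ^ 2) (x 6 ^ 2) (x 7 ^ 2) (x 5 ^ 2),
    -(3 + m) + 2 * x 0 * x 5 ^ 3 + 4 * (3 + m) * x 1 * x 5 ^ 3 *
      sPartialExpr (x 5 ^ 2) (x 2 ^ 2) (x 6 ^ 2) (x 3 ^ 2) (x 7 ^ 2) (x 4 ^ 2),
    -(3 + m) * m + 2 * x 0 * m * x 6 ^ 3 + 4 * (3 + m) * x 1 * x 6 ^ 3 *
      sPartialExpr (x 6 ^ 2) (x 2 ^ 2) (x 5 ^ 2) (x 4 ^ 2) (x 7 ^ 2) (x 3 ^ 2),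
    -(3 + m) * m + 2 * x 0 * m * x 7 ^ 3 + 4 * (3 + m) * x 1 * x 7 ^ 3 *
      sPartialExpr (x 7 ^ 2) (x 3 ^ 2) (x 5 ^ 2) (x 4 ^ 2) (x 6 ^ 2) (x 2 ^ 2)]

/-- The derivative with respect to `x` in the direction `v`. -/
def dirDeriv (e : PolyExpr Var) : PolyExpr Var :=
  ((List.finRange 8).map fun j => e.pderiv (.inl j) * var (.inr (.inr j))).sum

/-- The system `F = 0`, `v₇ = 1`, `DF v = 0` for the singular zeros of the Dziobek map. -/
def singularExpr : Var → PolyExpr Var :=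
  joint dziobekExpr (var (.inr (.inr 7)) - 1) fun i => dirDeriv (dziobekExpr i)

end PolyExpr

section DziobekDerivatives

open Matrix PolyExpr

variable (x v : Fin 8 → ℝ) (m : ℝ) (e : PolyExpr Var) (i j : Fin 8)

theorem contDiff_joint {k : WithTop ℕ∞} :
    ContDiff ℝ k (fun p : (Fin 8 → ℝ) × ℝ => joint p.1 p.2 v) := by
  refine contDiff_pi.2 ?_
  rintro (i | _ | i)
  · exact (contDiff_apply ℝ ℝ i).comp contDiff_fst
  · exact contDiff_snd
  · exact contDiff_const

theorem hasFDerivAt_eval_joint :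
    HasFDerivAt (fun y => e.eval (joint y m v))
      (∑ j, (e.pderiv (.inl j)).eval (joint x m v) •
        ContinuousLinearMap.proj (R := ℝ) (φ := fun _ => ℝ) j) x := by
  have joint_deriv : HasFDerivAt (fun y => joint y m v) (ContinuousLinearMap.pi
      (Sum.elim (ContinuousLinearMap.proj (R := ℝ) (φ := fun _ => ℝ)) fun _ => 0)) x := by
    refine hasFDerivAt_pi.2 ?_
    rintro (i | _ | i)
    · exact hasFDerivAt_apply (𝕜 := ℝ) i x
    · exact hasFDerivAt_const m x
    · exact hasFDerivAt_const (v i) x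
  refine ((e.hasFDerivAt_eval (joint x m v)).comp x joint_deriv).congr_fderiv ?_
  ext h
  simp

theorem hasDerivAt_eval_joint_mass :
    HasDerivAt (fun t => e.eval (joint x t v))
      ((e.pderiv (.inr (.inl ()))).eval (joint x m v)) m := by
  have joint_deriv : HasDerivAt (fun t => joint x t v) (joint 0 1 0) m := by
    refine hasDerivAt_pi.2 ?_
    rintro (i | _ | i)
    · exact hasDerivAt_const m (x i)
    · exact hasDerivAt_id m
    · exact hasDerivAt_const m (v i)
  refine ((e.hasFDerivAt_eval (joint x m v)).comp_hasDerivAt m joint_deriv).congr_deriv ?_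
  simp [joint]

theorem eval_dirDeriv :
    (dirDeriv e).eval (joint x m v) =
      ∑ j, (e.pderiv (.inl j)).eval (joint x m v) * v j := by
  rw [dirDeriv, eval_list_sum, List.map_map, ← Fin.sum_univ_def]
  rfl

theorem fderiv_eval_joint_apply :
    fderiv ℝ (fun y => e.eval (joint y m v)) x v = (dirDeriv e).eval (joint x m v) := by
  rw [(hasFDerivAt_eval_joint x v m e).fderiv, eval_dirDeriv]
  simp

theorem eval_dziobekExpr : (dziobekExpr i).eval (joint x m v) = dziobek x m i := by
  fin_cases i <;>
    simp [dziobekExpr, dziobek, joint, sPartialExpr, sPartial, weightedSquares, cayleyMenger_eq]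

theorem contDiff_dziobek {k : WithTop ℕ∞} :
    ContDiff ℝ k (fun p : (Fin 8 → ℝ) × ℝ => dziobek p.1 p.2) := by
  refine contDiff_pi.2 fun i => ?_
  simp only [← eval_dziobekExpr _ 0]
  exact (dziobekExpr i).contDiff_eval.comp (contDiff_joint 0)

theorem contDiff_dziobek_left {k : WithTop ℕ∞} : ContDiff ℝ k (fun y => dziobek y m) :=
  contDiff_dziobek.comp (f := fun y => (y, m)) (contDiff_id.prodMk contDiff_const)

theorem jacobian_mulVec (u : Fin 8 → ℝ) :
    jacobian dziobek x m *ᵥ u = fderiv ℝ (fun y => dziobek y m) x u := by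
  rw [jacobian, ← toLin'_apply, toLin'_toMatrix', ContinuousLinearMap.coe_coe]

theorem hasFDerivAt_dziobek_apply :
    HasFDerivAt (fun y => dziobek y m i)
      ((ContinuousLinearMap.proj (R := ℝ) (φ := fun _ => ℝ) i).comp
        (fderiv ℝ (fun y => dziobek y m) x)) x :=
  hasFDerivAt_pi'.1 ((contDiff_dziobek_left m (k := 1)).differentiable one_ne_zero x).hasFDerivAt i

theorem fderiv_dziobek_apply :
    fderiv ℝ (fun y => dziobek y m) x v i = (dirDeriv (dziobekExpr i)).eval (joint x m v) := by
  rw [← fderiv_eval_joint_apply]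
  simp only [eval_dziobekExpr, (hasFDerivAt_dziobek_apply x m i).fderiv]
  rfl

theorem jacobian_apply :
    jacobian dziobek x m i j = ((dziobekExpr i).pderiv (.inl j)).eval (joint x m v) := by
  have h := (hasFDerivAt_eval_joint x v m (dziobekExpr i)).fderiv
  simp only [eval_dziobekExpr, (hasFDerivAt_dziobek_apply x m i).fderiv] at h
  simpa [jacobian, LinearMap.toMatrix'_apply, Pi.single_apply] using
    congrArg (fun L => L (Pi.single j 1)) h

theorem fderiv_fderiv_dziobek_apply :
    fderiv ℝ (fderiv ℝ (fun y => dziobek y m)) x v v i =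
      (dirDeriv (dirDeriv (dziobekExpr i))).eval (joint x m v) := by
  have fderiv_differentiable : DifferentiableAt ℝ (fderiv ℝ (fun y => dziobek y m)) x :=
    ((contDiff_dziobek_left m (k := 2)).fderiv_right le_rfl).differentiable one_ne_zero x
  have h := hasFDerivAt_pi'.1
    (fderiv_differentiable.hasFDerivAt.clm_apply (hasFDerivAt_const v x)) i
  rw [← fderiv_eval_joint_apply]
  simp only [← fderiv_dziobek_apply, h.fderiv]
  simp

theorem deriv_dziobek_mass_apply :
    deriv (fun t => dziobek x t) m i =
      ((dziobekExpr i).pderiv (.inr (.inl ()))).eval (joint x m v) := by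
  have h : HasDerivAt (fun t => dziobek x t)
      (fun i => ((dziobekExpr i).pderiv (.inr (.inl ()))).eval (joint x m v)) m := by
    refine hasDerivAt_pi.2 fun i => ?_
    simpa only [eval_dziobekExpr] using hasDerivAt_eval_joint_mass x v m (dziobekExpr i)
  rw [h.deriv]

theorem eval_singularExpr_joint_eq_zero_iff :
    (fun k => (singularExpr k).eval (joint x m v)) = 0 ↔
      dziobek x m = 0 ∧ v 7 = 1 ∧ jacobian dziobek x m *ᵥ v = 0 := by
  simp only [funext_iff, Sum.forall, Pi.zero_apply, singularExpr, joint, Sum.elim_inl, Sum.elim_inr,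
    jacobian_mulVec]
  simp only [← joint.eq_def, eval_dziobekExpr, ← fderiv_dziobek_apply, eval_sub, eval_var, eval_one,
    forall_const, sub_eq_zero]
  rfl

end DziobekDerivatives

section Certificates

open Matrix
open scoped Matrix.Norms.Operator

theorem linfty_opNorm_le {m n : Type*} [Fintype m] [Fintype n] {A : Matrix m n ℝ} {r : ℝ}
    (hr : 0 ≤ r) (h : ∀ i, ∑ j, |A i j| ≤ r) : ‖A‖ ≤ r := by
  lift r to NNReal using hr
  rw [linfty_opNorm_def, NNReal.coe_le_coe, Finset.sup_le_iff]
  intro i _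
  rw [← NNReal.coe_le_coe, NNReal.coe_sum]
  exact h i

theorem Ball.norm_map_mid_mulVec_le {m n : Type*} [Fintype m] [Fintype n] {A : Matrix m n Ball}
    {b : n → Ball} {r : ℕ} (h : ∀ i, (A i ⬝ᵥ b).absBound ≤ r) {u : n → ℝ} (hu : ∀ i, u i ∈ b i) :
    ‖A.map mid *ᵥ u‖ ≤ r / scale := by
  refine (pi_norm_le_iff_of_nonneg (by positivity)).2 fun i => ?_
  calc ‖(A.map mid *ᵥ u) i‖ ≤ (A i ⬝ᵥ b).absBound / scale :=
        abs_le_absBound (dotProduct_mem_dotProduct (fun j => mid_mem (A i j)) hu)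
    _ ≤ r / scale := by
      gcongr
      exact h i

variable {ι : Type*} [Fintype ι] [DecidableEq ι]

namespace Ball

/-- A criterion for the real matrices in `M` to have an approximate inverse in `A`: the row sums
of `1 - A * M` are at most `1 / 2`. The kernel can decide it. -/
def IsApproxInv (A M : Matrix ι ι Ball) : Prop :=
  ∀ i, 2 * ∑ k, ((1 - A * M) i k).absBound ≤ scale

instance (A M : Matrix ι ι Ball) : Decidable (IsApproxInv A M) :=
  inferInstanceAs (Decidable (∀ _, _))

variable {A M : Matrix ι ι Ball} {N : Matrix ι ι ℝ}

theorem IsApproxInv.norm_one_sub_le (h : IsApproxInv A M) (hN : ∀ i j, N i j ∈ M i j) :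
    ‖1 - A.map mid * N‖ ≤ 1 / 2 := by
  have hS := scale_pos
  have one_apply_mem (i k : ι) : (1 : Matrix ι ι ℝ) i k ∈ (1 : Matrix ι ι Ball) i k := by
    rcases eq_or_ne i k with rfl | hik
    · simpa using one_mem
    · simpa [hik] using zero_mem
  have apply_mem (i k : ι) : (1 - A.map mid * N) i k ∈ (1 - A * M) i k :=
    sub_mem_sub (one_apply_mem i k)
      (dotProduct_mem_dotProduct (fun j => mid_mem (A i j)) fun j => hN j k)
  refine linfty_opNorm_le (by norm_num) fun i => ?_
  have row_bound : ((2 * ∑ k, ((1 - A * M) i k).absBound : ℕ) : ℝ) ≤ scale := by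
    exact_mod_cast h i
  push_cast at row_bound
  calc ∑ k, |(1 - A.map mid * N) i k|
      ≤ ∑ k, (((1 - A * M) i k).absBound / scale : ℝ) :=
        Finset.sum_le_sum fun k _ => abs_le_absBound (apply_mem i k)
    _ ≤ 1 / 2 := by
      rw [← Finset.sum_div, div_le_div_iff₀ hS two_pos]
      linarith

theorem IsApproxInv.det_ne_zero (h : IsApproxInv A M) (hN : ∀ i j, N i j ∈ M i j) : N.det ≠ 0 := by
  have := det_ne_zero_of_norm_one_sub_le (h.norm_one_sub_le hN)
  rw [det_mul] at this
  exact right_ne_zero_of_mul this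

theorem IsApproxInv.det_map_mid_ne_zero (h : IsApproxInv A M) : (A.map mid).det ≠ 0 := by
  have := det_ne_zero_of_norm_one_sub_le
    (h.norm_one_sub_le (N := M.map mid) fun i j => mid_mem (M i j))
  rw [det_mul] at this
  exact left_ne_zero_of_mul this

theorem mem_around_of_mulVec_eq {b : ι → Ball} {d : ι → ℤ} {k r : ℕ} (h : IsApproxInv A M)
    (hres : ∀ i, (A i ⬝ᵥ fun j => b j - M j ⬝ᵥ fun l => around (d l) k 0).absBound ≤ r)
    (hN : ∀ i j, N i j ∈ M i j) {u : ι → ℝ} (hu : ∀ i, (N *ᵥ u) i ∈ b i) (i : ι) :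
    u i ∈ around (d i) k (2 * r) := by
  let c : ι → ℝ := fun i => (around (d i) k 0).mid
  have residual_mem (j : ι) :
      (N *ᵥ u - N *ᵥ c) j ∈ b j - M j ⬝ᵥ fun l => around (d l) k 0 :=
    sub_mem_sub (hu j) (dotProduct_mem_dotProduct (hN j) fun l => mid_mem _)
  have norm_le := (norm_sub_le_of_mulVec_eq (h.norm_one_sub_le hN) rfl c).trans
    (mul_le_mul_of_nonneg_left (norm_map_mid_mulVec_le hres residual_mem) two_pos.le)
  rw [mem_iff_abs_sub_mid_le]
  calc |u i - (around (d i) k (2 * r)).mid| ≤ ‖u - c‖ := norm_le_pi_norm (u - c) i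
    _ ≤ 2 * (r / scale) := norm_le
    _ = (around (d i) k (2 * r)).radius / scale := by
      rw [around]
      push_cast
      ring

end Ball

open Ball

variable {g : ι → PolyExpr ι} {A : Matrix ι ι Ball} {b : ι → Ball}

theorem Ball.IsApproxInv.norm_comp_fderiv_sub_id_le
    (hA : IsApproxInv A (.of fun i j => ((g i).pderiv j).eval b)) {z : ι → ℝ}
    (hz : ∀ i, z i ∈ b i) :
    ‖(mulVecLin (A.map mid)).toContinuousLinearMap ∘L
      (mulVecLin (.of fun i j => ((g i).pderiv j).eval z)).toContinuousLinearMap - .id ℝ _‖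
        ≤ 1 / 2 := by
  refine le_trans (le_of_eq ?_)
    (hA.norm_one_sub_le (N := .of fun i j => ((g i).pderiv j).eval z)
      fun i j => eval_mem_eval hz ((g i).pderiv j))
  rw [norm_sub_rev, linfty_opNorm_eq_opNorm]
  congr 1
  ext u : 1
  simp

theorem injOn_eval_of_isApproxInv
    (hA : IsApproxInv A (.of fun i j => ((g i).pderiv j).eval b)) :
    Set.InjOn (fun z i => (g i).eval z) {z : ι → ℝ | ∀ i, z i ∈ b i} :=
  injOn_of_norm_comp_sub_id_le (c := 1 / 2) (convex_setOf_forall_mem b)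
    (fun z _ => (PolyExpr.hasFDerivAt_eval_pi g z).hasFDerivWithinAt) (by norm_num)
    fun z hz => by simpa using hA.norm_comp_fderiv_sub_id_le hz

theorem exists_eval_eq_zero_of_isApproxInv
    (hA : IsApproxInv A (.of fun i j => ((g i).pderiv j).eval b)) {d : ι → ℤ} {k r : ℕ}
    (hd : ∀ i, around (d i) k (2 * r) ≤ b i)
    (hres : ∀ i, (A i ⬝ᵥ fun j => (g j).eval fun l => around (d l) k 0).absBound ≤ r) :
    ∃ z : ι → ℝ, (∀ i, z i ∈ around (d i) k (2 * r)) ∧ (fun i => (g i).eval z) = 0 := by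
  have hS := scale_pos
  have mem_closedBall_iff (z : ι → ℝ) :
      z ∈ Metric.closedBall (fun i => (around (d i) k 0).mid) (2 * r / scale) ↔
        ∀ i, z i ∈ around (d i) k (2 * r) := by
    simp only [Metric.mem_closedBall, dist_pi_le_iff (by positivity : (0 : ℝ) ≤ 2 * r / scale),
      mem_iff_abs_sub_mid_le, Real.dist_eq]
    simp [around, mid]
  have mulVec_injective : Function.Injective (mulVecLin (A.map mid)).toContinuousLinearMap :=
    mulVec_injective_iff_isUnit.2 ((isUnit_iff_isUnit_det _).2 hA.det_map_mid_ne_zero.isUnit)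
  have residual_le := norm_map_mid_mulVec_le hres
    fun j => eval_mem_eval (fun l => mid_mem (around (d l) k 0)) (g j)
  obtain ⟨z, hz, hgz⟩ := exists_zero_mem_closedBall_of_norm_comp_sub_id_le (c := 1 / 2)
    (f' := fun z => (mulVecLin (.of fun i j => ((g i).pderiv j).eval z)).toContinuousLinearMap)
    (by positivity : (0 : ℝ) ≤ 2 * r / scale) (fun z _ => PolyExpr.hasFDerivAt_eval_pi g z)
    (fun z hz => by
      simpa using hA.norm_comp_fderiv_sub_id_le fun i =>
        mem_of_le (hd i) ((mem_closedBall_iff z).1 hz i))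
    mulVec_injective (residual_le.trans_eq (by push_cast; ring))
  exact ⟨z, (mem_closedBall_iff z).1 hz, hgz⟩

end Certificates

section CertificateData

open Matrix PolyExpr Ball

/-- The box `xBox` as a vector of intervals. -/
def xCell : Fin 8 → Ball :=
  ![.lastDigit 410486749931246396567394557 26, .lastDigit 7904883951465367 16,
    .lastDigit 98742601345654 14, .lastDigit 57921860462471 14, .lastDigit 100549177029900 14,
    .lastDigit 57921860462471 14, .lastDigit 100549177029900 14, .lastDigit 57304559793134 14]

/-- The interval `mBox` of masses. -/
def mCell : Ball := .lastDigit 100266054757261000068580350 26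

/-- `10³⁴` times the singular zero, rounded. -/
def xDigits : Fin 8 → ℤ :=
  ![41048674993124639656739455752552789, 7904883951465367924186251233040860,
    9874260134565408605160239309132235, 5792186046247189428947637162880095,
    10054917702990022812457778973449864, 5792186046247189428947637162880095,
    10054917702990022812457778973449864, 5730455979313458580485304546084097]

/-- `10³⁴` times the mass of the singular zero, rounded. -/
def mDigits : ℤ := 10026605475726100006858035021861154

/-- `10³⁴` times the null vector with last component `1`, rounded. -/
def vDigits : Fin 8 → ℤ :=
  ![0, -1790264478192246149789830174711189,
    29895142147557452742684426181231704, -5496816800145101566366981268870829,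
    -14331568125249437512893671899666954, -5496816800145101566366981268870829,
    -14331568125249437512893671899666954, 10000000000000000000000000000000000]

/-- `10²²` times the left null vector with last component `1`, rounded. -/
def wDigits : Fin 8 → ℤ :=
  ![0, -2353121308504796196433, 10068617794959297159991, -5380276783839489971739,
    -4654950135220327574696, -5380276783839489971739, -4654950135220327574696,
    10000000000000000000000]

/-- `10⁵` times an approximate inverse of the derivative of `singularExpr` at the solution. -/
def singularInvDigits : Matrix Var Var ℤ :=
  joint
    ![
      joint ![-153830, -267407, -26990, 42749, 30750, 42749, 30750, -17572] 0 0,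
      joint ![-69122, -14092, -21389, 18665, 7523, 18665, 7523, -11247] 0
        ![0, -2, 9, -5, -4, -5, -4, 9],
      joint ![12335, -14820, 5544, -1295, -1318, -1295, -1318, -311] 0
        ![0, 34, -146, 78, 67, 78, 67, -145],
      joint ![7235, 11880, 1957, -2349, 3780, 2304, -6068, 380] 0
        ![0, -6, 27, -14, -12, -14, -12, 27],
      joint ![12560, -3066, 1184, 13377, -12390, -16301, 10102, 4023] 0
        ![0, -16, 70, -37, -32, -37, -32, 69],
      joint ![7235, 11880, 1957, 2304, -6068, -2349, 3780, 380] 0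
        ![0, -6, 27, -14, -12, -14, -12, 27],
      joint ![12560, -3066, 1184, -16301, 10102, 13377, -12390, 4023] 0
        ![0, -16, 70, -37, -32, -37, -32, 69],
      joint ![7158, 8023, 572, -2325, 171, -2325, 171, 3725] 0 ![0, 11, -49, 26, 23, 26, 23, -48]]
    (joint ![0, 3620, -15487, 8276, 7160, 8276, 7160, -15382] 0 0)
    ![
      joint ![0, 53708, 0, 0, 0, 0, 0, 0] 0
        ![-153830, -276671, 12651, 21566, 12423, 21566, 12423, 21799],
      joint ![17891, -125113, 120470, -50582, -35777, -50582, -35777, 47838] (-17903)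
        ![-67840, -16732, -3847, 8929, -510, 8929, -510, 6741],
      joint ![0, 105269, -39983, 31630, -15040, 31630, -15040, 6866] 298951
        ![-9065, -39191, 5483, 4776, -2592, 4776, -2592, -9810],
      joint ![0, -36951, -2678, -579697, 557742, 576556, -544351, -7587] (-54968)
        ![11170, 16972, -647, -2067, 5224, 2585, -4624, -471],
      joint ![0, -6086, -2366, 1642317, -1557258, -1650575, 1579922, -12068] (-143316)
        ![22819, 9359, -1959, 12162, -10313, -17516, 12179, 5427],
      joint ![0, -36951, -2678, 576556, -544351, -579697, 557742, -7587] (-54968)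
        ![11170, 16972, -647, 2585, -4624, -2067, 5224, -471],
      joint ![0, -6086, -2366, -1650575, 1579922, 1642317, -1557258, -12068] (-143316)
        ![22819, 9359, -1959, -17516, 12179, 12162, -10313, 5427],
      joint 0 100000 0]

/-- `10⁵` times an approximate inverse of the Jacobian with row `2` replaced by `Pi.single 7 1`. -/
def kernelInvDigits : Matrix (Fin 8) (Fin 8) ℤ :=
  !![-153830, -273714, 0, 28327, 18272, 28327, 18272, 9234;
    -67840, -17631, -17903, 6874, -2288, 6874, -2288, 10561;
    -9065, -37910, 298951, 7706, -57, 7706, -57, -15256;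
    11170, 16821, -54968, -2413, 4925, 2239, -4924, 172;
    22819, 8901, -143316, 11115, -11219, -18563, 11274, 7372;
    11170, 16821, -54968, 2239, -4924, -2413, 4925, 172;
    22819, 8901, -143316, -18563, 11274, 11115, -11219, 7372;
    0, 0, 100000, 0, 0, 0, 0, 0]

/-- `10⁵` times an approximate inverse of the transposed Jacobian with row `2` replaced by
`Pi.single 7 1`. -/
def leftKernelInvDigits : Matrix (Fin 8) (Fin 8) ℤ :=
  !![-153830, -68383, 0, 9503, 18473, 9503, 18473, 3032;
    -271541, -17631, -23531, 9231, -9259, 9231, -9259, 13882;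
    -9298, -9714, 100686, 2651, -59, 2651, -59, -5138;
    33295, 12526, -53803, -2413, 14841, 2239, -14837, 168;
    22571, 2200, -46550, 3688, -11219, -6160, 11274, 2395;
    33295, 12526, -53803, 2239, -14837, -2413, 14841, 168;
    22571, 2200, -46550, -6160, 11274, 3688, -11219, 2395;
    0, 0, 100000, 0, 0, 0, 0, 0]

/-- The approximate inverse in `singularInvDigits` as a matrix of intervals. -/
def singularInv : Matrix Var Var Ball := singularInvDigits.map fun a => .around a 5 0

/-- The approximate inverse in `kernelInvDigits` as a matrix of intervals. -/
def kernelInv : Matrix (Fin 8) (Fin 8) Ball := kernelInvDigits.map fun a => .around a 5 0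

/-- The approximate inverse in `leftKernelInvDigits` as a matrix of intervals. -/
def leftKernelInv : Matrix (Fin 8) (Fin 8) Ball := leftKernelInvDigits.map fun a => .around a 5 0

/-- The box of the theorem, extended by an enclosure of the null vector that is valid for every
singular zero in it; see `mem_searchBox_of_mulVec_eq_zero`. -/
def searchBox : Var → Ball := joint xCell mCell fun i => .around (vDigits i) 34 (2 * 10 ^ 32)

/-- The box of radius `r` around the numerical solution. -/
def solutionBox (r : ℕ) : Var → Ball := fun i => .around (joint xDigits mDigits vDigits i) 34 r

/-- An enclosure of the left null vector. -/
def leftNullBox : Fin 8 → Ball := fun i => .around (wDigits i) 22 (2 * 10 ^ 20)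

/-- The box `vBox` of null vectors without the last component, which is exact. -/
def vCell : Fin 7 → Ball :=
  ![.lastDigit 0 9, .lastDigit (-179026448) 9, .lastDigit 2989514215 9, .lastDigit (-5496816801) 10,
    .lastDigit (-14331568126) 10, .lastDigit (-5496816801) 10, .lastDigit (-14331568126) 10]

/-- The box `wBox` of left null vectors without the last component, which is exact. -/
def wCell : Fin 7 → Ball :=
  ![.lastDigit 0 9, .lastDigit (-235312131) 9, .lastDigit 10068617795 10,
    .lastDigit (-5380276784) 10, .lastDigit (-46549501352) 11, .lastDigit (-5380276784) 10,
    .lastDigit (-46549501352) 11]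

/-- The Jacobian matrix of the Dziobek map in interval arithmetic. -/
def ballJacobian (b : Var → Ball) : Matrix (Fin 8) (Fin 8) Ball :=
  .of fun i j => ((dziobekExpr i).pderiv (.inl j)).eval b

/-- The Jacobian matrix with row `2` replaced by the linear form `v ↦ v 7`, over the box of the
theorem. It is invertible because the left null vector has a nonzero entry `2`. -/
def normalizedJacobian : Matrix (Fin 8) (Fin 8) Ball :=
  (ballJacobian (joint xCell mCell 0)).updateRow 2 (Pi.single 7 1)

/-- The transposed Jacobian matrix with row `2` replaced by the linear form `w ↦ w 7`, near the
solution. -/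
def normalizedJacobianTranspose : Matrix (Fin 8) (Fin 8) Ball :=
  (ballJacobian (solutionBox (2 * 10 ^ 10)))ᵀ.updateRow 2 (Pi.single 7 1)

theorem isApproxInv_kernelInv : IsApproxInv kernelInv normalizedJacobian := by
  decide +kernel

theorem absBound_kernelInv_residual_le (i : Fin 8) :
    (kernelInv i ⬝ᵥ fun j => Pi.single (M := fun _ => Ball) 2 1 j -
      normalizedJacobian j ⬝ᵥ fun l => .around (vDigits l) 34 0).absBound ≤ 10 ^ 32 := by
  revert i
  decide +kernel

theorem isApproxInv_singularInv :
    IsApproxInv singularInv (.of fun i j => ((singularExpr i).pderiv j).eval searchBox) := by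
  decide +kernel

theorem absBound_singularInv_residual_le (i : Var) :
    (singularInv i ⬝ᵥ fun j => (singularExpr j).eval (solutionBox 0)).absBound ≤ 10 ^ 10 := by
  revert i
  decide +kernel

theorem solutionBox_le_searchBox (i : Var) : solutionBox (2 * 10 ^ 10) i ≤ searchBox i := by
  revert i
  decide +kernel

theorem isApproxInv_leftKernelInv : IsApproxInv leftKernelInv normalizedJacobianTranspose := by
  decide +kernel

theorem absBound_leftKernelInv_residual_le (i : Fin 8) :
    (leftKernelInv i ⬝ᵥ fun j => Pi.single (M := fun _ => Ball) 2 1 j -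
      normalizedJacobianTranspose j ⬝ᵥ fun l => .around (wDigits l) 22 0).absBound ≤ 10 ^ 20 := by
  revert i
  decide +kernel

theorem solutionBox_le_vCell (i : Fin 7) :
    solutionBox (2 * 10 ^ 10) (.inr (.inr i.castSucc)) ≤ vCell i := by
  revert i
  decide +kernel

theorem leftNullBox_le_wCell (i : Fin 7) : leftNullBox i.castSucc ≤ wCell i := by
  revert i
  decide +kernel

theorem leftNullBox_dotProduct_massDeriv_le :
    (leftNullBox ⬝ᵥ fun i => ((dziobekExpr i).pderiv (.inr (.inl ()))).eval
      (solutionBox (2 * 10 ^ 10))) ≤ .lastDigit (-6501134640) 9 := by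
  decide +kernel

theorem leftNullBox_dotProduct_secondDeriv_le :
    (leftNullBox ⬝ᵥ fun i => (dirDeriv (dirDeriv (dziobekExpr i))).eval
      (solutionBox (2 * 10 ^ 10))) ≤ .lastDigit (-206664414) 5 := by
  decide +kernel

end CertificateData

/-! ### Fold bifurcations -/

section Fold

open Filter Function Set

theorem exists_strictMonoOn_of_deriv_deriv_pos {g : ℝ → ℝ} (hc : ∀ᶠ s in 𝓝 0, ContinuousAt g s)
    (h1 : deriv g 0 = 0) (h2 : 0 < deriv (deriv g) 0) :
    ∃ η > 0, ContinuousOn g (Icc (-η) η) ∧ StrictMonoOn g (Icc 0 η) ∧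
      StrictAntiOn g (Icc (-η) 0) := by
  obtain ⟨δ, hδ, h⟩ := Metric.eventually_nhds_iff.1
    (hc.and (eventually_nhdsWithin_sign_eq_of_deriv_pos h2 h1))
  have hmem : ∀ s ∈ Icc (-(δ / 2)) (δ / 2), dist s 0 < δ := fun s hs => by
    rw [Real.dist_0_eq_abs, abs_lt]
    constructor <;> linarith [hs.1, hs.2]
  have hcont : ContinuousOn g (Icc (-(δ / 2)) (δ / 2)) := fun s hs =>
    (h (hmem s hs)).1.continuousWithinAt
  refine ⟨δ / 2, by positivity, hcont, ?_, ?_⟩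
  · refine strictMonoOn_of_deriv_pos (convex_Icc _ _)
      (hcont.mono (Icc_subset_Icc_left (by linarith))) fun s hs => ?_
    rw [interior_Icc] at hs
    have hsign := (h (hmem s ⟨by linarith [hs.1], hs.2.le⟩)).2
    rw [sub_zero, sign_pos hs.1] at hsign
    exact sign_eq_one_iff.1 hsign
  · refine strictAntiOn_of_deriv_neg (convex_Icc _ _)
      (hcont.mono (Icc_subset_Icc_right (by linarith))) fun s hs => ?_
    rw [interior_Icc] at hs
    have hsign := (h (hmem s ⟨hs.1.le, by linarith [hs.2]⟩)).2
    rw [sub_zero, sign_neg hs.2] at hsign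
    exact sign_eq_neg_one_iff.1 hsign

section LevelSets

variable {g : ℝ → ℝ} {η : ℝ}

theorem lt_of_strictMonoOn_of_strictAntiOn (hmono : StrictMonoOn g (Icc 0 η))
    (hanti : StrictAntiOn g (Icc (-η) 0)) {s : ℝ} (hs : s ∈ Icc (-η) η) (hs0 : s ≠ 0) :
    g 0 < g s := by
  have hη : 0 ≤ η := by linarith [hs.1, hs.2]
  rcases hs0.lt_or_gt with h | h
  · exact hanti ⟨hs.1, h.le⟩ (right_mem_Icc.2 (by linarith)) h
  · exact hmono (left_mem_Icc.2 hη) ⟨h.le, hs.2⟩ h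

theorem ncard_levelSet_eq_two (hη : 0 ≤ η) (hcont : ContinuousOn g (Icc (-η) η))
    (hmono : StrictMonoOn g (Icc 0 η)) (hanti : StrictAntiOn g (Icc (-η) 0)) {c : ℝ}
    (h0c : g 0 < c) (hcr : c < g η) (hcl : c < g (-η)) :
    {s ∈ Ioo (-η) η | g s = c}.ncard = 2 := by
  obtain ⟨s, hs, hgs⟩ := intermediate_value_Ioo hη
    (hcont.mono (Icc_subset_Icc_left (by linarith))) ⟨h0c, hcr⟩
  obtain ⟨t, ht, hgt⟩ := intermediate_value_Ioo' (by linarith : -η ≤ 0)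
    (hcont.mono (Icc_subset_Icc_right hη)) ⟨h0c, hcl⟩
  have hset : {s ∈ Ioo (-η) η | g s = c} = {s, t} := by
    ext r
    constructor
    · rintro ⟨hr, hgr⟩
      rcases le_total 0 r with h0 | h0
      · exact Or.inl (hmono.injOn ⟨h0, hr.2.le⟩ (Ioo_subset_Icc_self hs) (hgr.trans hgs.symm))
      · exact Or.inr (hanti.injOn ⟨hr.1.le, h0⟩ (Ioo_subset_Icc_self ht) (hgr.trans hgt.symm))
    · rintro (rfl | rfl)
      · exact ⟨⟨by linarith [hs.1], hs.2⟩, hgs⟩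
      · exact ⟨⟨ht.1, by linarith [ht.2]⟩, hgt⟩
  rw [hset]
  exact ncard_pair (ht.2.trans hs.1).ne'

theorem eventually_levelSet_of_deriv_deriv_pos (hc : ∀ᶠ s in 𝓝 0, ContinuousAt g s)
    (h0 : g 0 = 0) (h1 : deriv g 0 = 0) (h2 : 0 < deriv (deriv g) 0) :
    ∀ᶠ η in 𝓝[>] 0, ∀ᶠ c in 𝓝 0, (0 < c → {s ∈ Ioo (-η) η | g s = c}.ncard = 2) ∧
      (c = 0 → {s ∈ Ioo (-η) η | g s = c} = {0}) ∧
      (c < 0 → {s ∈ Ioo (-η) η | g s = c} = ∅) := by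
  obtain ⟨η₁, hη₁, hcont₁, hmono₁, hanti₁⟩ := exists_strictMonoOn_of_deriv_deriv_pos hc h1 h2
  filter_upwards [Ioo_mem_nhdsGT hη₁] with η ⟨hη, hηη₁⟩
  have hcont := hcont₁.mono (Icc_subset_Icc (neg_le_neg hηη₁.le) hηη₁.le)
  have hmono := hmono₁.mono (Icc_subset_Icc_right hηη₁.le)
  have hanti := hanti₁.mono (Icc_subset_Icc_left (neg_le_neg hηη₁.le))
  have hpos : ∀ s ∈ Icc (-η) η, s ≠ 0 → 0 < g s := fun s hs hs0 =>
    h0 ▸ lt_of_strictMonoOn_of_strictAntiOn hmono hanti hs hs0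
  filter_upwards [eventually_lt_nhds (hpos η ⟨by linarith, le_rfl⟩ hη.ne'),
    eventually_lt_nhds (hpos (-η) ⟨le_rfl, by linarith⟩ (neg_ne_zero.2 hη.ne'))] with c hcr hcl
  refine ⟨fun h => ncard_levelSet_eq_two hη.le hcont hmono hanti (h0.trans_lt h) hcr hcl,
    fun h => ?_, fun h => eq_empty_of_forall_notMem ?_⟩
  · refine Subset.antisymm (fun s hs => ?_) ?_
    · by_contra hs0
      exact (hpos s (Ioo_subset_Icc_self hs.1) hs0).ne' (hs.2.trans h)
    · rintro _ rfl
      exact ⟨⟨by linarith, hη⟩, h0.trans h.symm⟩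
  · rintro s ⟨hs, hgs⟩
    rcases eq_or_ne s 0 with rfl | hs0
    · linarith
    · linarith [hpos s (Ioo_subset_Icc_self hs) hs0]

end LevelSets

theorem eventually_forall_mem_Ioo_neg {p : ℝ → Prop} (h : ∀ᶠ s in 𝓝 0, p s) :
    ∀ᶠ η in 𝓝[>] 0, ∀ s ∈ Ioo (-η) η, p s := by
  obtain ⟨δ, hδ, hp⟩ := Metric.eventually_nhds_iff.1 h
  filter_upwards [Ioo_mem_nhdsGT hδ] with η hη s hs
  exact hp (by rw [Real.dist_0_eq_abs]; exact (abs_lt.2 hs).trans hη.2)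

variable {E : Type*} [NormedAddCommGroup E] [NormedSpace ℝ E]

theorem differentiableAt_deriv_of_contDiffAt {f : ℝ → E} {s : ℝ} (hf : ContDiffAt ℝ 2 f s) :
    DifferentiableAt ℝ (deriv f) s :=
  ((hf.fderiv_right (m := 1) (by norm_num)).differentiableAt (by norm_num)).clm_apply
    (differentiableAt_const 1)

variable {F : E → ℝ → E} {ℓ φ : E →L[ℝ] ℝ} {x₀ v : E} {m₀ : ℝ} {γ : ℝ → E} {μ : ℝ → ℝ}

theorem fderiv_apply_left (hF : Differentiable ℝ (uncurry F)) (x : E) (m : ℝ) :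
    fderiv ℝ (fun y => F y m) x =
      (fderiv ℝ (uncurry F) (x, m)).comp (ContinuousLinearMap.inl ℝ E ℝ) :=
  (HasFDerivAt.comp (g := uncurry F) (f := fun y => (y, m)) x
    (hF (x, m)).hasFDerivAt (hasFDerivAt_prodMk_left x m)).fderiv

theorem deriv_apply_right (hF : Differentiable ℝ (uncurry F)) (x : E) (m : ℝ) :
    deriv (fun t => F x t) m = fderiv ℝ (uncurry F) (x, m) (0, 1) :=
  ((hF (x, m)).hasFDerivAt.comp_hasDerivAt m
    ((hasDerivAt_const m x).prodMk (hasDerivAt_id m))).deriv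

theorem fderiv_uncurry_apply (hF : Differentiable ℝ (uncurry F)) (x u : E) (m k : ℝ) :
    fderiv ℝ (uncurry F) (x, m) (u, k) =
      fderiv ℝ (fun y => F y m) x u + k • deriv (fun t => F x t) m := by
  rw [fderiv_apply_left hF, deriv_apply_right hF, ContinuousLinearMap.comp_apply,
    ContinuousLinearMap.inl_apply, ← map_smul, ← map_add]
  simp

theorem fderiv_fderiv_apply_left (hF : ContDiff ℝ 2 (uncurry F)) (x u : E) (m : ℝ) :
    fderiv ℝ (fderiv ℝ (fun y => F y m)) x u u =
      fderiv ℝ (fderiv ℝ (uncurry F)) (x, m) (u, 0) (u, 0) := by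
  have hT : Differentiable ℝ (fderiv ℝ (uncurry F)) :=
    (hF.fderiv_right (m := 1) (by norm_num)).differentiable (by norm_num)
  have hcomp := (HasFDerivAt.comp (g := fderiv ℝ (uncurry F)) (f := fun y => (y, m)) x
    (hT (x, m)).hasFDerivAt (hasFDerivAt_prodMk_left x m)).clm_comp
    (hasFDerivAt_const (ContinuousLinearMap.inl ℝ E ℝ) x)
  rw [funext fun y => fderiv_apply_left (hF.differentiable (by norm_num)) y m]
  refine (congrArg (fun T => T u u) hcomp.fderiv).trans ?_
  simp

theorem eventually_apply_sub_mem_Ioo (ℓ : E →L[ℝ] ℝ) (x₀ : E) {η : ℝ} (hη : 0 < η) :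
    ∀ᶠ x in 𝓝 x₀, ℓ (x - x₀) ∈ Ioo (-η) η :=
  ((ℓ.continuous.comp (continuous_sub_right x₀)).tendsto' x₀ 0 (by simp)).eventually_mem
    (Ioo_mem_nhds (neg_lt_zero.2 hη) hη)

/-- The zero set of `F` near `(x₀, m₀)` is the analytic curve `s ↦ (γ s, μ s)`, where the parameter
`s` of a zero `(x, m)` is `ℓ (x - x₀)`. -/
structure IsZeroCurve (F : E → ℝ → E) (ℓ : E →L[ℝ] ℝ) (x₀ : E) (m₀ : ℝ) (γ : ℝ → E)
    (μ : ℝ → ℝ) : Prop where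
  contDiffAt_fst : ContDiffAt ℝ ω γ 0
  contDiffAt_snd : ContDiffAt ℝ ω μ 0
  fst_zero : γ 0 = x₀
  snd_zero : μ 0 = m₀
  eventually_eq_zero : ∀ᶠ s in 𝓝 0, F (γ s) (μ s) = 0
  eventually_apply_sub : ∀ᶠ s in 𝓝 0, ℓ (γ s - x₀) = s
  eventually_eq_of_eq_zero : ∀ᶠ p in 𝓝 (x₀, m₀), F p.1 p.2 = 0 →
    γ (ℓ (p.1 - x₀)) = p.1 ∧ μ (ℓ (p.1 - x₀)) = p.2

theorem injective_fderiv_prod (hF : Differentiable ℝ (uncurry F))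
    (hker : ∀ u, fderiv ℝ (fun y => F y m₀) x₀ u = 0 → u = ℓ u • v)
    (hφ : ∀ u, φ (fderiv ℝ (fun y => F y m₀) x₀ u) = 0)
    (ha : φ (deriv (fun t => F x₀ t) m₀) ≠ 0) :
    Injective ((fderiv ℝ (uncurry F) (x₀, m₀)).prod
      (ℓ.comp (ContinuousLinearMap.fst ℝ E ℝ))) := by
  rw [injective_iff_map_eq_zero]
  rintro ⟨u, k⟩ huk
  have hDF : fderiv ℝ (uncurry F) (x₀, m₀) (u, k) = 0 := congrArg Prod.fst huk
  have hℓu : ℓ u = 0 := congrArg Prod.snd huk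
  rw [fderiv_uncurry_apply hF] at hDF
  have hk : k = 0 := by
    have := congrArg φ hDF
    rw [map_add, hφ, map_smul, map_zero, zero_add, smul_eq_mul] at this
    exact (mul_eq_zero.1 this).resolve_right ha
  rw [hk, zero_smul, add_zero] at hDF
  have hu : u = 0 := by rw [hker u hDF, hℓu, zero_smul]
  rw [hu, hk, Prod.mk_zero_zero]

theorem exists_isZeroCurve_of_openPartialHomeomorph (P : OpenPartialHomeomorph (E × ℝ) (E × ℝ))
    (hP : ∀ p, P p = (F p.1 p.2, ℓ (p.1 - x₀))) (hsource : (x₀, m₀) ∈ P.source)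
    (hF0 : F x₀ m₀ = 0) (hsymm : ContDiffAt ℝ ω P.symm (0, 0)) :
    ∃ γ μ, IsZeroCurve F ℓ x₀ m₀ γ μ := by
  have hP0 : P (x₀, m₀) = (0, 0) := by simp [hP, hF0]
  have hsymm0 : P.symm (0, 0) = (x₀, m₀) := by rw [← hP0, P.left_inv hsource]
  have hcurve : ContDiffAt ℝ ω (fun s : ℝ => P.symm ((0 : E), s)) 0 :=
    ContDiffAt.comp (g := P.symm) (f := fun s : ℝ => ((0 : E), s)) 0 hsymm
      (contDiffAt_const.prodMk contDiffAt_id)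
  have htarget : ∀ᶠ s : ℝ in 𝓝 0, ((0 : E), s) ∈ P.target :=
    (show ContinuousAt (fun s : ℝ => ((0 : E), s)) 0 by fun_prop)
      (P.open_target.mem_nhds (by simpa only [hP0] using P.map_source hsource))
  have hright : ∀ᶠ s : ℝ in 𝓝 0, (F (P.symm (0, s)).1 (P.symm (0, s)).2,
      ℓ ((P.symm (0, s)).1 - x₀)) = (0, s) :=
    htarget.mono fun s hs => by rw [← hP, P.right_inv hs]
  refine ⟨fun s => (P.symm (0, s)).1, fun s => (P.symm (0, s)).2, hcurve.fst, hcurve.snd,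
    congrArg Prod.fst hsymm0, congrArg Prod.snd hsymm0,
    hright.mono fun s hs => congrArg Prod.fst hs, hright.mono fun s hs => congrArg Prod.snd hs, ?_⟩
  filter_upwards [P.open_source.mem_nhds hsource] with p hp hp0
  have hleft : P.symm (0, ℓ (p.1 - x₀)) = p := by rw [← hp0, ← hP, P.left_inv hp]
  exact ⟨congrArg Prod.fst hleft, congrArg Prod.snd hleft⟩

theorem exists_isZeroCurve [FiniteDimensional ℝ E] (hF : ContDiff ℝ ω (uncurry F))
    (hF0 : F x₀ m₀ = 0)
    (hker : ∀ u, fderiv ℝ (fun y => F y m₀) x₀ u = 0 → u = ℓ u • v)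
    (hφ : ∀ u, φ (fderiv ℝ (fun y => F y m₀) x₀ u) = 0)
    (ha : φ (deriv (fun t => F x₀ t) m₀) ≠ 0) :
    ∃ γ μ, IsZeroCurve F ℓ x₀ m₀ γ μ := by
  have hd : Differentiable ℝ (uncurry F) := hF.differentiable (by norm_num)
  let Φ : E × ℝ → E × ℝ := fun p => (F p.1 p.2, ℓ (p.1 - x₀))
  have hΦ : ContDiff ℝ ω Φ := hF.prodMk (ℓ.contDiff.comp (contDiff_fst.sub contDiff_const))
  have hΦ' : HasFDerivAt Φ ((fderiv ℝ (uncurry F) (x₀, m₀)).prod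
      (ℓ.comp (ContinuousLinearMap.fst ℝ E ℝ))) (x₀, m₀) :=
    (hd (x₀, m₀)).hasFDerivAt.prodMk
      (ℓ.hasFDerivAt.comp (x₀, m₀) (hasFDerivAt_fst.sub_const x₀))
  let e : (E × ℝ) ≃L[ℝ] (E × ℝ) :=
    (LinearEquiv.ofInjectiveEndo _ (injective_fderiv_prod hd hker hφ ha)).toContinuousLinearEquiv
  have he : HasFDerivAt Φ (e : E × ℝ →L[ℝ] E × ℝ) (x₀, m₀) := hΦ'.congr_fderiv (by ext <;> rfl)
  have hΦ0 : Φ (x₀, m₀) = (0, 0) := by simp [Φ, hF0]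
  have : CompleteSpace E := FiniteDimensional.complete ℝ E
  have hω : (ω : WithTop ℕ∞) ≠ 0 := by decide
  exact exists_isZeroCurve_of_openPartialHomeomorph
    (hΦ.contDiffAt.toOpenPartialHomeomorph Φ he hω) (fun _ => rfl)
    (hΦ.contDiffAt.mem_toOpenPartialHomeomorph_source he hω) hF0
    (hΦ0 ▸ hΦ.contDiffAt.to_localInverse he hω)

namespace IsZeroCurve

theorem apply_deriv_eq_one (h : IsZeroCurve F ℓ x₀ m₀ γ μ) : ℓ (deriv γ 0) = 1 := by
  have hγ := (h.contDiffAt_fst.differentiableAt (by norm_num)).hasDerivAt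
  rw [← (ℓ.hasFDerivAt.comp_hasDerivAt 0 (hγ.sub_const x₀)).deriv]
  exact (EventuallyEq.deriv_eq h.eventually_apply_sub).trans (deriv_id (0 : ℝ))

theorem eventually_fderiv_apply_eq_zero (h : IsZeroCurve F ℓ x₀ m₀ γ μ)
    (hF : Differentiable ℝ (uncurry F)) :
    ∀ᶠ s in 𝓝 0, fderiv ℝ (uncurry F) (γ s, μ s) (deriv γ s, deriv μ s) = 0 := by
  filter_upwards [h.eventually_eq_zero.eventually_nhds, h.contDiffAt_fst.eventually (by decide),
    h.contDiffAt_snd.eventually (by decide)] with s hs hγs hμs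
  have hcomp := (hF (γ s, μ s)).hasFDerivAt.comp_hasDerivAt s
    ((hγs.differentiableAt (by norm_num)).hasDerivAt.prodMk
      (hμs.differentiableAt (by norm_num)).hasDerivAt)
  rw [← hcomp.deriv]
  exact (EventuallyEq.deriv_eq hs).trans (deriv_const s (0 : E))

theorem deriv_snd_eq_zero (h : IsZeroCurve F ℓ x₀ m₀ γ μ) (hF : Differentiable ℝ (uncurry F))
    (hφ : ∀ u, φ (fderiv ℝ (fun y => F y m₀) x₀ u) = 0)
    (ha : φ (deriv (fun t => F x₀ t) m₀) ≠ 0) : deriv μ 0 = 0 := by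
  have h0 := congrArg φ (h.eventually_fderiv_apply_eq_zero hF).self_of_nhds
  rw [h.fst_zero, h.snd_zero, fderiv_uncurry_apply hF, map_add, hφ, map_smul, map_zero, zero_add,
    smul_eq_mul] at h0
  exact (mul_eq_zero.1 h0).resolve_right ha

theorem deriv_fst_eq (h : IsZeroCurve F ℓ x₀ m₀ γ μ) (hF : Differentiable ℝ (uncurry F))
    (hker : ∀ u, fderiv ℝ (fun y => F y m₀) x₀ u = 0 → u = ℓ u • v) (hμ : deriv μ 0 = 0) :
    deriv γ 0 = v := by
  have h0 := (h.eventually_fderiv_apply_eq_zero hF).self_of_nhds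
  rw [h.fst_zero, h.snd_zero, fderiv_uncurry_apply hF, hμ, zero_smul, add_zero] at h0
  simpa only [h.apply_deriv_eq_one, one_smul] using hker _ h0

-- Differentiate `F (γ s) (μ s) = 0` twice at `0` and apply `φ`, which kills the second derivative
-- of `γ`.
theorem deriv_deriv_snd_eq (h : IsZeroCurve F ℓ x₀ m₀ γ μ) (hF : ContDiff ℝ 2 (uncurry F))
    (hφ : ∀ u, φ (fderiv ℝ (fun y => F y m₀) x₀ u) = 0)
    (ha : φ (deriv (fun t => F x₀ t) m₀) ≠ 0) :
    deriv (deriv μ) 0 = -φ (fderiv ℝ (fderiv ℝ (fun y => F y m₀)) x₀ (deriv γ 0) (deriv γ 0)) /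
      φ (deriv (fun t => F x₀ t) m₀) := by
  have hd : Differentiable ℝ (uncurry F) := hF.differentiable (by norm_num)
  have hT : Differentiable ℝ (fderiv ℝ (uncurry F)) :=
    (hF.fderiv_right (m := 1) (by norm_num)).differentiable (by norm_num)
  have hγ := (h.contDiffAt_fst.differentiableAt (by norm_num)).hasDerivAt
  have hμ := (h.contDiffAt_snd.differentiableAt (by norm_num)).hasDerivAt
  have hγ' := (differentiableAt_deriv_of_contDiffAt (h.contDiffAt_fst.of_le le_top)).hasDerivAt
  have hμ' := (differentiableAt_deriv_of_contDiffAt (h.contDiffAt_snd.of_le le_top)).hasDerivAt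
  have hT' := (hT (γ 0, μ 0)).hasFDerivAt.comp_hasDerivAt (0 : ℝ) (hγ.prodMk hμ)
  have hsecond := hT'.clm_apply (hγ'.prodMk hμ')
  have hzero : deriv (fun s => fderiv ℝ (uncurry F) (γ s, μ s) (deriv γ s, deriv μ s)) 0 = 0 :=
    (EventuallyEq.deriv_eq (h.eventually_fderiv_apply_eq_zero hd)).trans (deriv_const (0 : ℝ) 0)
  have hφzero := congrArg φ (hsecond.deriv.symm.trans hzero)
  simp only [h.fst_zero, h.snd_zero, h.deriv_snd_eq_zero hd hφ ha, Function.comp] at hφzero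
  rw [map_add, fderiv_uncurry_apply hd, map_add, hφ, map_smul, map_zero, zero_add, smul_eq_mul,
    ← fderiv_fderiv_apply_left hF] at hφzero
  rw [eq_div_iff ha]
  linarith

theorem eventually_injOn (h : IsZeroCurve F ℓ x₀ m₀ γ μ) :
    ∀ᶠ η in 𝓝[>] 0, InjOn γ (Ioo (-η) η) := by
  filter_upwards [eventually_forall_mem_Ioo_neg h.eventually_apply_sub] with η hη s hs t ht hst
  rw [← hη s hs, ← hη t ht, hst]

theorem exists_curve (h : IsZeroCurve F ℓ x₀ m₀ γ μ) :
    ∃ δ > 0, ContDiffOn ℝ ∞ γ (Ioo (-δ) δ) ∧ ContDiffOn ℝ ∞ μ (Ioo (-δ) δ) ∧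
      InjOn γ (Ioo (-δ) δ) ∧ ∃ N ∈ 𝓝 (x₀, m₀),
        {p : E × ℝ | p ∈ N ∧ F p.1 p.2 = 0} = (fun s => (γ s, μ s)) '' Ioo (-δ) δ := by
  obtain ⟨δ, hinj, hδs, hδ⟩ := (h.eventually_injOn.and ((eventually_forall_mem_Ioo_neg
    ((h.contDiffAt_fst.eventually (by decide)).and <| (h.contDiffAt_snd.eventually (by decide)).and
      <| h.eventually_eq_zero.and h.eventually_apply_sub)).and self_mem_nhdsWithin)).exists
  refine ⟨δ, hδ, fun s hs => ((hδs s hs).1.of_le le_top).contDiffWithinAt,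
    fun s hs => ((hδs s hs).2.1.of_le le_top).contDiffWithinAt, hinj, _,
    h.eventually_eq_of_eq_zero.and ((eventually_apply_sub_mem_Ioo ℓ x₀ hδ).prod_inl_nhds m₀), ?_⟩
  ext p
  constructor
  · rintro ⟨⟨hp, hmem⟩, hp0⟩
    exact ⟨ℓ (p.1 - x₀), hmem, Prod.ext (hp hp0).1 (hp hp0).2⟩
  · rintro ⟨s, hs, rfl⟩
    obtain ⟨-, -, hz, hℓs⟩ := hδs s hs
    refine ⟨⟨fun _ => ?_, ?_⟩, hz⟩
    · simp only [hℓs, and_self]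
    · simpa only [hℓs] using hs

theorem eventually_exists_zeroSet_eq_image (h : IsZeroCurve F ℓ x₀ m₀ γ μ) {W : Set E}
    (hW : W ∈ 𝓝 x₀) :
    ∀ᶠ η in 𝓝[>] 0, ∃ U ∈ 𝓝 x₀, U ⊆ W ∧ ∀ᶠ m in 𝓝 m₀,
      {x | x ∈ U ∧ F x m = 0} = γ '' {s ∈ Ioo (-η) η | μ s = m} := by
  obtain ⟨A, hA, B, hB, hAB⟩ := eventually_prod_iff.1
    (nhds_prod_eq (x := x₀) (y := m₀) ▸ h.eventually_eq_of_eq_zero)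
  have hγA : ∀ᶠ s in 𝓝 0, γ s ∈ W ∧ A (γ s) :=
    h.contDiffAt_fst.continuousAt.eventually (by rw [h.fst_zero]; exact inter_mem hW hA)
  filter_upwards [self_mem_nhdsWithin, eventually_forall_mem_Ioo_neg
    (hγA.and <| h.eventually_eq_zero.and h.eventually_apply_sub)] with η hη hs
  refine ⟨{x | (x ∈ W ∧ A x) ∧ ℓ (x - x₀) ∈ Ioo (-η) η},
    inter_mem (inter_mem hW hA) (eventually_apply_sub_mem_Ioo ℓ x₀ hη), fun x hx => hx.1.1, ?_⟩
  filter_upwards [hB] with m hm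
  ext x
  constructor
  · rintro ⟨⟨⟨-, hx⟩, hmem⟩, hx0⟩
    obtain ⟨hγx, hμm⟩ := hAB hx hm hx0
    exact ⟨ℓ (x - x₀), ⟨hmem, hμm⟩, hγx⟩
  · rintro ⟨s, ⟨hsη, rfl⟩, rfl⟩
    obtain ⟨hsW, hz, hℓs⟩ := hs s hsη
    exact ⟨⟨hsW, hℓs.symm ▸ hsη⟩, hz⟩

theorem exists_solutions (h : IsZeroCurve F ℓ x₀ m₀ γ μ) (hμ : deriv μ 0 = 0) {σ : ℝ}
    (hσ : 0 < σ * deriv (deriv μ) 0) {W : Set E} (hW : W ∈ 𝓝 x₀) :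
    ∃ U ∈ 𝓝 x₀, U ⊆ W ∧ ∃ ε > 0, ∀ m : ℝ, |m - m₀| < ε →
      (0 < σ * (m - m₀) → {x | x ∈ U ∧ F x m = 0}.ncard = 2) ∧
      (m = m₀ → {x | x ∈ U ∧ F x m = 0} = {x₀}) ∧
      (σ * (m - m₀) < 0 → {x | x ∈ U ∧ F x m = 0} = ∅) := by
  have hderiv : deriv (fun s => σ * (μ s - m₀)) = fun s => σ * deriv μ s := by
    funext s
    rw [deriv_const_mul_field, deriv_sub_const]
  have hlevel := eventually_levelSet_of_deriv_deriv_pos (g := fun s => σ * (μ s - m₀))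
    ((h.contDiffAt_snd.eventually (by decide)).mono fun s hs =>
      (hs.continuousAt.sub continuousAt_const).const_mul σ)
    (by simp [h.snd_zero]) (by simp [hderiv, hμ]) (by simpa [hderiv] using hσ)
  obtain ⟨η, hη, hinj, U, hU, hUW, hsol⟩ := (hlevel.and <| h.eventually_injOn.and <|
    h.eventually_exists_zeroSet_eq_image hW).exists
  have hm : Tendsto (fun m => σ * (m - m₀)) (𝓝 m₀) (𝓝 0) :=
    Continuous.tendsto' (by fun_prop) _ _ (by simp)
  obtain ⟨ε, hε, hall⟩ := Metric.eventually_nhds_iff.1 (hsol.and (hm.eventually hη))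
  refine ⟨U, hU, hUW, ε, hε, fun m hmε => ?_⟩
  obtain ⟨hset, htwo, hone, hnone⟩ := hall (by rwa [Real.dist_eq])
  have hσ0 : σ ≠ 0 := left_ne_zero_of_mul hσ.ne'
  simp only [mul_right_inj' hσ0, sub_left_inj] at htwo hone hnone
  rw [hset]
  refine ⟨fun hpos => ?_, fun hzero => ?_, fun hneg => ?_⟩
  · rw [(hinj.mono fun s hs => hs.1).ncard_image, htwo hpos]
  · rw [hone (by simp [hzero]), image_singleton, h.fst_zero]
  · rw [hnone hneg, image_empty]

end IsZeroCurve

theorem isFoldBifurcation_of_simple_kernel [FiniteDimensional ℝ E]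
    (hF : ContDiff ℝ ω (uncurry F)) (hF0 : F x₀ m₀ = 0) (hv : v ≠ 0)
    (hker : ∀ u, fderiv ℝ (fun y => F y m₀) x₀ u = 0 → u = ℓ u • v)
    (hφ : ∀ u, φ (fderiv ℝ (fun y => F y m₀) x₀ u) = 0)
    (ha : φ (deriv (fun t => F x₀ t) m₀) ≠ 0) {σ : ℝ}
    (hσ : 0 < σ * (-φ (fderiv ℝ (fderiv ℝ (fun y => F y m₀)) x₀ v v) /
      φ (deriv (fun t => F x₀ t) m₀))) :
    IsFoldBifurcation F x₀ m₀ σ := by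
  have hd : Differentiable ℝ (uncurry F) := hF.differentiable (by norm_num)
  obtain ⟨γ, μ, h⟩ := exists_isZeroCurve hF hF0 hker hφ ha
  have hμ' := h.deriv_snd_eq_zero hd hφ ha
  have hγ' := h.deriv_fst_eq hd hker hμ'
  have hμ'' := h.deriv_deriv_snd_eq (hF.of_le le_top) hφ ha
  rw [← hγ', ← hμ''] at hσ
  obtain ⟨δ, hδ, hγδ, hμδ, hinj, hN⟩ := h.exists_curve
  exact ⟨⟨γ, μ, δ, hδ, hγδ, hμδ, hinj, h.fst_zero, h.snd_zero, hγ' ▸ hv, hμ', hσ, hN⟩,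
    fun W hW => h.exists_solutions hμ' hσ hW⟩

end Fold

/-! ### Planar configurations with prescribed distances -/

section CentralConfiguration

open Finset

-- `m_i m_j (r_ij⁻³ - a) = b Δ_i Δ_j` are Dziobek's equations: the term with `b` drops out of the
-- force because `Δ` is an affine dependence of the points.
theorem isCentralConfiguration_of_affine_dependence {n d : ℕ} {μ Δ : Fin n → ℝ}
    {q : Fin n → EuclideanSpace ℝ (Fin d)} (hq : Function.Injective q) (hμ : ∀ i, μ i ≠ 0)
    (hM : ∑ i, μ i ≠ 0) (hΔ : ∑ i, Δ i = 0) (hΔq : ∑ i, Δ i • q i = 0) {a b : ℝ}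
    (h : ∀ i j, i ≠ j → μ i * μ j / dist (q i) (q j) ^ 3 = a * (μ i * μ j) + b * (Δ i * Δ j)) :
    IsCentralConfiguration μ q := by
  refine ⟨hq, -a * ∑ i, μ i, fun j => smul_right_injective _ (hμ j) ?_⟩
  have hcenter : (∑ i, μ i) • (q j - centerOfMass μ q) = (∑ i, μ i) • q j - ∑ i, μ i • q i := by
    rw [centerOfMass, smul_sub, smul_inv_smul₀ hM]
  have hforce : ∀ i ∈ univ.erase j, μ j • (μ i / dist (q i) (q j) ^ 3) • (q i - q j) =
      (a * (μ i * μ j) + b * (Δ i * Δ j)) • (q i - q j) := fun i hi => by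
    rw [smul_smul, ← h i j (ne_of_mem_erase hi)]
    ring_nf
  symm
  calc μ j • ∑ i ∈ univ.erase j, (μ i / dist (q i) (q j) ^ 3) • (q i - q j)
      = ∑ i, (a * (μ i * μ j) + b * (Δ i * Δ j)) • (q i - q j) := by
        rw [smul_sum, sum_congr rfl hforce, sum_erase _ (by simp)]
    _ = (a * μ j) • (∑ i, μ i • q i - (∑ i, μ i) • q j) +
          (b * Δ j) • (∑ i, Δ i • q i - (∑ i, Δ i) • q j) := by
        simp only [sum_smul, ← sum_sub_distrib, smul_sum, ← sum_add_distrib]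
        refine sum_congr rfl fun i _ => ?_
        module
    _ = μ j • (-a * ∑ i, μ i) • (q j - centerOfMass μ q) := by
        rw [hΔ, hΔq, mul_smul (-a), hcenter]
        module

/-- Twice the signed area of the triangle `a b c` in the plane. -/
def signedArea (a b c : EuclideanSpace ℝ (Fin 2)) : ℝ :=
  (b 0 - a 0) * (c 1 - a 1) - (b 1 - a 1) * (c 0 - a 0)

/-- The signed areas of the four triangles formed by `q`, with alternating signs: they are the
coefficients of the affine dependence of four points in the plane. -/
def signedAreas (q : Fin 4 → EuclideanSpace ℝ (Fin 2)) : Fin 4 → ℝ :=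
  ![signedArea (q 1) (q 2) (q 3), -signedArea (q 0) (q 2) (q 3), signedArea (q 0) (q 1) (q 3),
    -signedArea (q 0) (q 1) (q 2)]

theorem sum_signedAreas (q : Fin 4 → EuclideanSpace ℝ (Fin 2)) : ∑ i, signedAreas q i = 0 := by
  simp only [signedAreas, signedArea, Fin.sum_univ_four, Matrix.cons_val]
  ring

theorem sum_signedAreas_smul (q : Fin 4 → EuclideanSpace ℝ (Fin 2)) :
    ∑ i, signedAreas q i • q i = 0 := by
  ext k
  fin_cases k <;> simp [signedAreas, signedArea, Fin.sum_univ_four] <;> ring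

theorem dist_sq_eq (u v : EuclideanSpace ℝ (Fin 2)) :
    dist u v ^ 2 = (u 0 - v 0) ^ 2 + (u 1 - v 1) ^ 2 := by
  rw [EuclideanSpace.dist_sq_eq, Fin.sum_univ_two, Real.dist_eq, Real.dist_eq, sq_abs, sq_abs]

theorem sPartial_dist_sq (a b c d : EuclideanSpace ℝ (Fin 2)) :
    sPartial (dist a b ^ 2) (dist a c ^ 2) (dist a d ^ 2) (dist b c ^ 2) (dist b d ^ 2)
      (dist c d ^ 2) = 4 * (signedArea b c d * signedArea a c d) := by
  simp only [dist_sq_eq, sPartial, signedArea]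
  ring

theorem div_dist_pow_three_eq {a b c d : EuclideanSpace ℝ (Fin 2)} {l μ m k : ℝ} (hm : 0 < m)
    (hab : 0 < dist a b)
    (h : -(3 + m) * k + 2 * l * k * dist a b ^ 3 + 4 * (3 + m) * μ * dist a b ^ 3 *
      sPartial (dist a b ^ 2) (dist a c ^ 2) (dist a d ^ 2) (dist b c ^ 2) (dist b d ^ 2)
        (dist c d ^ 2) = 0) :
    k / dist a b ^ 3 =
      2 * l / (3 + m) * k + 16 * μ * (signedArea b c d * signedArea a c d) := by
  rw [sPartial_dist_sq] at h
  field_simp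
  linear_combination -h

namespace HasMutualDistances

variable {q : Fin 4 → EuclideanSpace ℝ (Fin 2)} {x : Fin 8 → ℝ}

theorem dist_pos_of_lt (h : HasMutualDistances q x) (hx : ∀ k, 2 ≤ k → 0 < x k) {i j : Fin 4}
    (hij : i < j) : 0 < dist (q i) (q j) := by
  obtain ⟨h01, h02, h03, h12, h13, h23⟩ := h
  fin_cases i <;> fin_cases j <;> first
    | exact absurd hij (by decide)
    | exact h01 ▸ hx 2 (by decide)
    | exact h02 ▸ hx 3 (by decide)
    | exact h03 ▸ hx 4 (by decide)
    | exact h12 ▸ hx 5 (by decide)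
    | exact h13 ▸ hx 6 (by decide)
    | exact h23 ▸ hx 7 (by decide)

theorem injective (h : HasMutualDistances q x) (hx : ∀ k, 2 ≤ k → 0 < x k) :
    Function.Injective q := by
  intro i j hij
  by_contra hne
  wlog hlt : i < j generalizing i j
  · exact this hij.symm (Ne.symm hne) ((lt_or_gt_of_ne hne).resolve_left hlt)
  · exact (dist_pos.1 (h.dist_pos_of_lt hx hlt)) hij

theorem mul_div_dist_pow_eq_of_lt {m : ℝ} (hm : 0 < m) (hx : ∀ k, 2 ≤ k → 0 < x k)
    (h : HasMutualDistances q x) (hF : dziobek x m = 0) {i j : Fin 4} (hij : i < j) :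
    mass m i * mass m j / dist (q i) (q j) ^ 3 = 2 * x 0 / (3 + m) * (mass m i * mass m j) +
      -16 * x 1 * (signedAreas q i * signedAreas q j) := by
  have hpos := h.dist_pos_of_lt hx hij
  obtain ⟨h01, h02, h03, h12, h13, h23⟩ := h
  have h10 : dist (q 1) (q 0) = x 2 := (dist_comm _ _).trans h01
  have key (c d : Fin 4) (hF : -(3 + m) * (mass m i * mass m j) +
        2 * x 0 * (mass m i * mass m j) * dist (q i) (q j) ^ 3 +
        4 * (3 + m) * x 1 * dist (q i) (q j) ^ 3 * sPartial (dist (q i) (q j) ^ 2)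
          (dist (q i) (q c) ^ 2) (dist (q i) (q d) ^ 2) (dist (q j) (q c) ^ 2)
          (dist (q j) (q d) ^ 2) (dist (q c) (q d) ^ 2) = 0)
      (hΔ : signedArea (q j) (q c) (q d) * signedArea (q i) (q c) (q d) =
        -(signedAreas q i * signedAreas q j)) :
      mass m i * mass m j / dist (q i) (q j) ^ 3 = 2 * x 0 / (3 + m) * (mass m i * mass m j) +
        -16 * x 1 * (signedAreas q i * signedAreas q j) := by
    rw [div_dist_pow_three_eq hm hpos hF, hΔ]
    ring
  fin_cases i <;> fin_cases j <;> try exact absurd hij (by decide)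
  · refine key 2 3 ?_ (by simp [signedAreas, signedArea]; ring)
    simpa [dziobek, mass, h01, h02, h03, h12, h13, h23] using congrFun hF 2
  · refine key 1 3 ?_ (by simp [signedAreas, signedArea]; ring)
    simpa [dziobek, mass, h01, h02, h03, h12, h13, h23, dist_comm] using congrFun hF 3
  · refine key 1 2 ?_ (by simp [signedAreas, signedArea]; ring)
    simpa [dziobek, mass, h01, h02, h03, h12, h13, h23, dist_comm] using congrFun hF 4
  · refine key 0 3 ?_ (by simp [signedAreas, signedArea]; ring)
    simpa [dziobek, mass, h10, h02, h03, h12, h13, h23, dist_comm] using congrFun hF 5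
  · refine key 0 2 ?_ (by simp [signedAreas, signedArea]; ring)
    simpa [dziobek, mass, h10, h02, h03, h12, h13, h23, dist_comm] using congrFun hF 6
  · refine key 0 1 ?_ (by simp [signedAreas, signedArea]; ring)
    simpa [dziobek, mass, h01, h02, h03, h12, h13, h23, dist_comm] using congrFun hF 7

theorem mul_div_dist_pow_eq {m : ℝ} (hm : 0 < m) (hx : ∀ k, 2 ≤ k → 0 < x k)
    (h : HasMutualDistances q x) (hF : dziobek x m = 0) {i j : Fin 4} (hij : i ≠ j) :
    mass m i * mass m j / dist (q i) (q j) ^ 3 = 2 * x 0 / (3 + m) * (mass m i * mass m j) +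
      -16 * x 1 * (signedAreas q i * signedAreas q j) := by
  rcases hij.lt_or_gt with hlt | hlt
  · exact h.mul_div_dist_pow_eq_of_lt hm hx hF hlt
  · rw [dist_comm, mul_comm (mass m i), mul_comm (signedAreas q i)]
    exact h.mul_div_dist_pow_eq_of_lt hm hx hF hlt

theorem isCentralConfiguration {m : ℝ} (hm : 0 < m) (hx : ∀ k, 2 ≤ k → 0 < x k)
    (h : HasMutualDistances q x) (hF : dziobek x m = 0) :
    IsCentralConfiguration (mass m) q := by
  refine isCentralConfiguration_of_affine_dependence (h.injective hx) ?_ ?_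
    (sum_signedAreas q) (sum_signedAreas_smul q) fun i j => h.mul_div_dist_pow_eq hm hx hF
  · intro i
    fin_cases i <;> simp [mass, hm.ne']
  · simp only [mass, Fin.sum_univ_four, Matrix.cons_val]
    positivity

end HasMutualDistances

end CentralConfiguration

section Kite

/-- The kite with the vertices `(-p, 0)`, `(p, 0)`, `(0, y)`, `(0, z)`. -/
def kite (p y z : ℝ) : Fin 4 → EuclideanSpace ℝ (Fin 2) :=
  ![!₂[-p, 0], !₂[p, 0], !₂[0, y], !₂[0, z]]

theorem hasMutualDistances_kite_iff {p y z : ℝ} {x : Fin 8 → ℝ} (hx : ∀ k, 2 ≤ k → 0 ≤ x k) :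
    HasMutualDistances (kite p y z) x ↔ x 2 ^ 2 = 4 * p ^ 2 ∧ x 3 ^ 2 = p ^ 2 + y ^ 2 ∧
      x 4 ^ 2 = p ^ 2 + z ^ 2 ∧ x 5 ^ 2 = p ^ 2 + y ^ 2 ∧ x 6 ^ 2 = p ^ 2 + z ^ 2 ∧
      x 7 ^ 2 = (z - y) ^ 2 := by
  have hdist : ∀ {u v : EuclideanSpace ℝ (Fin 2)} {k : Fin 8}, 2 ≤ k →
      (dist u v = x k ↔ x k ^ 2 = (u 0 - v 0) ^ 2 + (u 1 - v 1) ^ 2) := fun hk => by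
    rw [← sq_eq_sq₀ dist_nonneg (hx _ hk), dist_sq_eq, eq_comm]
  simp only [HasMutualDistances, kite, Matrix.cons_val]
  rw [hdist (by decide), hdist (by decide), hdist (by decide), hdist (by decide),
    hdist (by decide), hdist (by decide)]
  simp only [Matrix.cons_val]
  ring_nf

theorem cayleyMenger_kite {p y z : ℝ} {x : Fin 8 → ℝ} (h2 : x 2 ^ 2 = 4 * p ^ 2)
    (h3 : x 3 ^ 2 = p ^ 2 + y ^ 2) (h4 : x 4 ^ 2 = p ^ 2 + z ^ 2) (h5 : x 5 = x 3)
    (h6 : x 6 = x 4) :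
    cayleyMenger x = 8 * p ^ 2 * ((2 * y * z - (y ^ 2 + z ^ 2 - x 7 ^ 2)) *
      (2 * y * z + (y ^ 2 + z ^ 2 - x 7 ^ 2))) := by
  rw [cayleyMenger_eq, h5, h6, h2, h3, h4]
  ring

theorem exists_pos_sq_eq_add_sq {r p : ℝ} (h : p ^ 2 < r ^ 2) : ∃ y > 0, r ^ 2 = p ^ 2 + y ^ 2 :=
  ⟨√(r ^ 2 - p ^ 2), Real.sqrt_pos.2 (sub_pos.2 h), by rw [Real.sq_sqrt (sub_pos.2 h).le]; ring⟩

theorem exists_kite_hasMutualDistances {x : Fin 8 → ℝ} (hx : ∀ k, 2 ≤ k → 0 < x k)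
    (h5 : x 5 = x 3) (h6 : x 6 = x 4) (hS : cayleyMenger x = 0) (h34 : x 3 < x 4)
    (h23 : x 2 ^ 2 < 4 * x 3 ^ 2) (h27 : x 2 ^ 2 / 2 + x 7 ^ 2 < x 3 ^ 2 + x 4 ^ 2) :
    ∃ p y z, 0 < p ∧ 0 < y ∧ y < z ∧ HasMutualDistances (kite p y z) x := by
  have hp : 0 < x 2 / 2 := half_pos (hx 2 (by decide))
  have hp2 : x 2 ^ 2 = 4 * (x 2 / 2) ^ 2 := by ring
  set p := x 2 / 2
  have h34' : x 3 ^ 2 < x 4 ^ 2 := pow_lt_pow_left₀ h34 (hx 3 (by decide)).le two_ne_zero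
  obtain ⟨y, hy, hy2⟩ := exists_pos_sq_eq_add_sq (show p ^ 2 < x 3 ^ 2 by linarith)
  obtain ⟨z, hz, hz2⟩ := exists_pos_sq_eq_add_sq (show p ^ 2 < x 4 ^ 2 by linarith)
  rw [cayleyMenger_kite hp2 hy2 hz2 h5 h6] at hS
  have hpos : 0 < 2 * y * z + (y ^ 2 + z ^ 2 - x 7 ^ 2) := by
    have : 0 < 2 * y * z := by positivity
    linarith
  have hzero := (mul_eq_zero.1 ((mul_eq_zero.1 hS).resolve_left (by positivity))).resolve_right
    hpos.ne'
  refine ⟨p, y, z, hp, hy, lt_of_pow_lt_pow_left₀ 2 hz.le (by linarith),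
    (hasMutualDistances_kite_iff fun k hk => (hx k hk).le).2
      ⟨hp2, hy2, hz2, h5 ▸ hy2, h6 ▸ hz2, by linarith⟩⟩

theorem eq_smul_kite_add_smul_kite_add_smul_kite {p y z : ℝ} (hp : p ≠ 0) (hz : z ≠ 0)
    (u : EuclideanSpace ℝ (Fin 2)) :
    u = ((1 - u 1 / z - u 0 / p) / 2) • kite p y z 0 +
      ((1 - u 1 / z + u 0 / p) / 2) • kite p y z 1 + (u 1 / z) • kite p y z 3 := by
  ext i
  fin_cases i <;> simp [kite] <;> field_simp
  ring

theorem kite_two_mem_interior_convexHull {p y z : ℝ} (hp : 0 < p) (hy : 0 < y) (hyz : y < z) :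
    kite p y z 2 ∈ interior (convexHull ℝ {kite p y z 0, kite p y z 1, kite p y z 3}) := by
  have hz : 0 < z := hy.trans hyz
  let O : Set (EuclideanSpace ℝ (Fin 2)) := {u | 0 < u 1 / z} ∩
    ({u | 0 < (1 - u 1 / z + u 0 / p) / 2} ∩ {u | 0 < (1 - u 1 / z - u 0 / p) / 2})
  have hO : IsOpen O := by
    refine (isOpen_lt continuous_const ?_).inter
      ((isOpen_lt continuous_const ?_).inter (isOpen_lt continuous_const ?_)) <;> fun_prop
  have hOsub : O ⊆ convexHull ℝ {kite p y z 0, kite p y z 1, kite p y z 3} := by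
    rintro u ⟨h3, h1, h0⟩
    rw [eq_smul_kite_add_smul_kite_add_smul_kite (y := y) hp.ne' hz.ne' u]
    exact mem_convexHull_of_exists_fintype ![_, _, _] ![kite p y z 0, kite p y z 1, kite p y z 3]
      (by simpa [Fin.forall_fin_succ] using ⟨h0.le, h1.le, h3.le⟩)
      (by simp only [Fin.sum_univ_three, Matrix.cons_val]; ring)
      (by simp [Fin.forall_fin_succ]) (by simp [Fin.sum_univ_three])
  have hmem : kite p y z 2 ∈ O := by
    have : y / z < 1 := (div_lt_one hz).2 hyz
    simpa [O, kite, hz, hy] using this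
  exact interior_maximal hOsub hO hmem

end Kite

/-! ### The singular solution -/

section SingularSolution

open Matrix Ball PolyExpr

theorem Ball.updateRow_single_mem {m n : Type*} [DecidableEq m] [DecidableEq n]
    {M : Matrix m n Ball} {N : Matrix m n ℝ} (h : ∀ i j, N i j ∈ M i j) (k i : m) (l j : n) :
    N.updateRow k (Pi.single l 1) i j ∈ M.updateRow k (Pi.single l 1) i j := by
  rcases eq_or_ne i k with rfl | hik
  · rcases eq_or_ne j l with rfl | hjl
    · simpa using one_mem
    · simpa [hjl] using zero_mem
  · simpa [hik] using h i j

theorem Ball.single_mem_single {ι : Type*} [DecidableEq ι] (k i : ι) :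
    (Pi.single k 1 : ι → ℝ) i ∈ (Pi.single k 1 : ι → Ball) i := by
  rcases eq_or_ne i k with rfl | hik
  · simpa using one_mem
  · simpa [hik] using zero_mem

variable {x v w y : Fin 8 → ℝ} {m m' : ℝ}

theorem forall_joint_mem_iff {X V : Fin 8 → Ball} {M : Ball} :
    (∀ i, joint x m v i ∈ joint X M V i) ↔ (∀ i, x i ∈ X i) ∧ m ∈ M ∧ ∀ i, v i ∈ V i := by
  simp [joint, Sum.forall]

theorem mem_xBox_iff : x ∈ xBox ↔ ∀ i, x i ∈ xCell i := by
  simp only [xBox, xCell, Set.mem_ofPred_eq, Fin.forall_fin_succ, cons_val_zero, cons_val_succ,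
    Fin.succ_zero_eq_one, Fin.succ_one_eq_two, Fin.reduceSucc,
    mem_lastDigit_iff, Nat.reduceLeDiff]
  norm_num

theorem mem_mBox_iff : m ∈ mBox ↔ m ∈ mCell := by
  norm_num [mBox, mCell, mem_lastDigit_iff]

theorem mem_vBox_iff : v ∈ vBox ↔ (∀ i : Fin 7, v i.castSucc ∈ vCell i) ∧ v 7 = 1 := by
  simp only [vBox, vCell, Set.mem_ofPred_eq, Fin.forall_fin_succ, cons_val_zero, cons_val_succ,
    Fin.castSucc_zero, Fin.castSucc_succ, Fin.succ_zero_eq_one, Fin.succ_one_eq_two, Fin.reduceSucc,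
    mem_lastDigit_iff, Nat.reduceLeDiff]
  norm_num [and_assoc]

theorem mem_wBox_iff : w ∈ wBox ↔ (∀ i : Fin 7, w i.castSucc ∈ wCell i) ∧ w 7 = 1 := by
  simp only [wBox, wCell, Set.mem_ofPred_eq, Fin.forall_fin_succ, cons_val_zero, cons_val_succ,
    Fin.castSucc_zero, Fin.castSucc_succ, Fin.succ_zero_eq_one, Fin.succ_one_eq_two, Fin.reduceSucc,
    mem_lastDigit_iff, Nat.reduceLeDiff]
  norm_num [and_assoc]

theorem jacobian_mem_ballJacobian {b : Var → Ball} (hz : ∀ i, joint x m v i ∈ b i) (i j : Fin 8) :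
    jacobian dziobek x m i j ∈ ballJacobian b i j := by
  rw [jacobian_apply x v m]
  exact eval_mem_eval hz _

theorem updateRow_jacobian_mem (hx : x ∈ xBox) (hm : m ∈ mBox) (i j : Fin 8) :
    (jacobian dziobek x m).updateRow 2 (Pi.single 7 1) i j ∈ normalizedJacobian i j :=
  updateRow_single_mem (jacobian_mem_ballJacobian <| forall_joint_mem_iff.2
    ⟨mem_xBox_iff.1 hx, mem_mBox_iff.1 hm, fun _ => zero_mem⟩) _ _ _ _

theorem det_updateRow_jacobian_ne_zero (hx : x ∈ xBox) (hm : m ∈ mBox) :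
    ((jacobian dziobek x m).updateRow 2 (Pi.single 7 1)).det ≠ 0 :=
  isApproxInv_kernelInv.det_ne_zero (updateRow_jacobian_mem hx hm)

theorem mem_searchBox_of_mulVec_eq_zero (hx : x ∈ xBox) (hm : m ∈ mBox)
    (hv : jacobian dziobek x m *ᵥ v = 0) (hv7 : v 7 = 1) : ∀ i, joint x m v i ∈ searchBox i := by
  refine forall_joint_mem_iff.2 ⟨mem_xBox_iff.1 hx, mem_mBox_iff.1 hm,
    mem_around_of_mulVec_eq isApproxInv_kernelInv absBound_kernelInv_residual_le
      (updateRow_jacobian_mem hx hm) fun i => ?_⟩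
  rw [updateRow_single_mulVec hv, hv7]
  exact single_mem_single 2 i

theorem eq_of_singular (hx : x ∈ xBox) (hm : m ∈ mBox) (hF : dziobek x m = 0)
    (hdet : (jacobian dziobek x m).det = 0) (hy : y ∈ xBox) (hm' : m' ∈ mBox)
    (hF' : dziobek y m' = 0) (hdet' : (jacobian dziobek y m').det = 0) : y = x ∧ m' = m := by
  obtain ⟨v, hv, hv7⟩ :=
    exists_mulVec_eq_zero_apply_eq_one hdet (det_updateRow_jacobian_ne_zero hx hm)
  obtain ⟨u, hu, hu7⟩ :=
    exists_mulVec_eq_zero_apply_eq_one hdet' (det_updateRow_jacobian_ne_zero hy hm')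
  have hjoint : joint y m' u = joint x m v :=
    injOn_eval_of_isApproxInv isApproxInv_singularInv
      (mem_searchBox_of_mulVec_eq_zero hy hm' hu hu7) (mem_searchBox_of_mulVec_eq_zero hx hm hv hv7)
      (((eval_singularExpr_joint_eq_zero_iff y u m').2 ⟨hF', hu7, hu⟩).trans
        ((eval_singularExpr_joint_eq_zero_iff x v m).2 ⟨hF, hv7, hv⟩).symm)
  exact ⟨funext fun i => congrFun hjoint (.inl i), congrFun hjoint (.inr (.inl ()))⟩

theorem exists_singular_mem_solutionBox : ∃ x m v,
    (∀ i, joint x m v i ∈ solutionBox (2 * 10 ^ 10) i) ∧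
      dziobek x m = 0 ∧ v 7 = 1 ∧ jacobian dziobek x m *ᵥ v = 0 := by
  obtain ⟨z, hz, hz0⟩ := exists_eval_eq_zero_of_isApproxInv isApproxInv_singularInv
    solutionBox_le_searchBox absBound_singularInv_residual_le
  obtain ⟨x, m, v, rfl⟩ : ∃ x m v, joint x m v = z :=
    ⟨fun i => z (.inl i), z (.inr (.inl ())), fun i => z (.inr (.inr i)), by
      ext (i | i | i) <;> rfl⟩
  exact ⟨x, m, v, hz, (eval_singularExpr_joint_eq_zero_iff x v m).1 hz0⟩

theorem mem_xBox_and_mem_mBox (hz : ∀ i, joint x m v i ∈ solutionBox (2 * 10 ^ 10) i) :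
    x ∈ xBox ∧ m ∈ mBox := by
  obtain ⟨hx, hm, -⟩ :=
    forall_joint_mem_iff.1 fun i => mem_of_le (solutionBox_le_searchBox i) (hz i)
  exact ⟨mem_xBox_iff.2 hx, mem_mBox_iff.2 hm⟩

theorem mem_vBox (hz : ∀ i, joint x m v i ∈ solutionBox (2 * 10 ^ 10) i) (hv7 : v 7 = 1) :
    v ∈ vBox :=
  mem_vBox_iff.2 ⟨fun i => mem_of_le (solutionBox_le_vCell i) (hz (.inr (.inr _))), hv7⟩

theorem mem_wBox (hw : ∀ i, w i ∈ leftNullBox i) (hw7 : w 7 = 1) : w ∈ wBox :=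
  mem_wBox_iff.2 ⟨fun i => mem_of_le (leftNullBox_le_wCell i) (hw _), hw7⟩

theorem exists_leftNullVector (hz : ∀ i, joint x m v i ∈ solutionBox (2 * 10 ^ 10) i)
    (hdet : (jacobian dziobek x m).det = 0) :
    ∃ w, (jacobian dziobek x m)ᵀ *ᵥ w = 0 ∧ w 7 = 1 ∧ ∀ i, w i ∈ leftNullBox i := by
  have hJ : ∀ i j, (jacobian dziobek x m)ᵀ.updateRow 2 (Pi.single 7 1) i j ∈
      normalizedJacobianTranspose i j := fun i j =>
    updateRow_single_mem (fun i j => jacobian_mem_ballJacobian hz j i) _ _ _ _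
  obtain ⟨w, hw, hw7⟩ := exists_mulVec_eq_zero_apply_eq_one
    (by rw [det_transpose, hdet]) (isApproxInv_leftKernelInv.det_ne_zero hJ)
  refine ⟨w, hw, hw7, mem_around_of_mulVec_eq isApproxInv_leftKernelInv
    absBound_leftKernelInv_residual_le hJ fun i => ?_⟩
  rw [updateRow_single_mulVec hw, hw7]
  exact single_mem_single 2 i

theorem dotProduct_deriv_mass_mem (hz : ∀ i, joint x m v i ∈ solutionBox (2 * 10 ^ 10) i)
    (hw : ∀ i, w i ∈ leftNullBox i) :
    w ⬝ᵥ deriv (fun t => dziobek x t) m ∈ decimalInterval (-6.501134640) 9 := by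
  have hmem : w ⬝ᵥ deriv (fun t => dziobek x t) m ∈ lastDigit (-6501134640) 9 :=
    mem_of_le leftNullBox_dotProduct_massDeriv_le <| dotProduct_mem_dotProduct hw fun i => by
      rw [deriv_dziobek_mass_apply x v m]
      exact eval_mem_eval hz _
  convert (mem_lastDigit_iff (by norm_num)).1 hmem using 1
  norm_num

theorem dotProduct_fderiv_fderiv_mem (hz : ∀ i, joint x m v i ∈ solutionBox (2 * 10 ^ 10) i)
    (hw : ∀ i, w i ∈ leftNullBox i) :
    w ⬝ᵥ fderiv ℝ (fderiv ℝ (fun y => dziobek y m)) x v v ∈ decimalInterval (-2066.64414) 5 := by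
  have hmem : w ⬝ᵥ fderiv ℝ (fderiv ℝ (fun y => dziobek y m)) x v v ∈ lastDigit (-206664414) 5 :=
    mem_of_le leftNullBox_dotProduct_secondDeriv_le <| dotProduct_mem_dotProduct hw fun i => by
      rw [fderiv_fderiv_dziobek_apply x v m]
      exact eval_mem_eval hz _
  convert (mem_lastDigit_iff (by norm_num)).1 hmem using 1
  norm_num

theorem isFoldBifurcation_dziobek (hF : dziobek x m = 0) (hv : v ≠ 0)
    (hker : ∀ u, jacobian dziobek x m *ᵥ u = 0 → u = u 7 • v)
    (hw : (jacobian dziobek x m)ᵀ *ᵥ w = 0)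
    (hFm : w ⬝ᵥ deriv (fun t => dziobek x t) m < 0)
    (hFvv : w ⬝ᵥ fderiv ℝ (fderiv ℝ (fun y => dziobek y m)) x v v < 0) :
    IsFoldBifurcation dziobek x m (-1) := by
  refine isFoldBifurcation_of_simple_kernel (ℓ := .proj 7)
    (φ := (dotProductBilin ℝ ℝ w).toContinuousLinearMap) contDiff_dziobek hF hv
    (fun u hu => hker u (by rw [jacobian_mulVec, hu])) (fun u => ?_) hFm.ne ?_
  · change w ⬝ᵥ _ = 0
    rw [← jacobian_mulVec, dotProduct_mulVec, ← mulVec_transpose, hw, zero_dotProduct]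
  · change 0 < -1 * (-(w ⬝ᵥ _) / (w ⬝ᵥ _))
    have := div_pos_of_neg_of_neg hFvv hFm
    rwa [neg_div, neg_one_mul, neg_neg]

end SingularSolution

section Symmetry

variable {x : Fin 8 → ℝ} {m : ℝ}

/-- `swap12` as a continuous linear map. -/
noncomputable def swap12CLM : (Fin 8 → ℝ) →L[ℝ] (Fin 8 → ℝ) :=
  (LinearMap.funLeft ℝ ℝ ![0, 1, 2, 5, 6, 3, 4, 7]).toContinuousLinearMap

theorem swap12CLM_apply (x : Fin 8 → ℝ) : swap12CLM x = swap12 x := by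
  ext i
  fin_cases i <;> rfl

theorem swap12_involutive : Function.Involutive swap12 := by
  intro x
  ext i
  fin_cases i <;> rfl

theorem swap12_zero : swap12 0 = 0 := by
  rw [← swap12CLM_apply, map_zero]

theorem swap12_mem_xBox (hx : x ∈ xBox) : swap12 x ∈ xBox := by
  obtain ⟨h0, h1, h2, h3, h4, h5, h6, h7⟩ := hx
  exact ⟨h0, h1, h2, h5, h6, h3, h4, h7⟩

theorem dziobek_swap12 (x : Fin 8 → ℝ) (m : ℝ) : dziobek (swap12 x) m = swap12 (dziobek x m) := by
  ext i
  fin_cases i <;>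
    simp only [Fin.mk_zero, Fin.mk_one, Fin.reduceFinMk, dziobek, swap12, weightedSquares,
      cayleyMenger_eq, sPartial, Matrix.cons_val] <;> ring

theorem jacobian_swap12_mulVec (x v : Fin 8 → ℝ) (m : ℝ) :
    (jacobian dziobek (swap12 x) m).mulVec (swap12 v) =
      swap12 ((jacobian dziobek x m).mulVec v) := by
  have hd : Differentiable ℝ (fun y => dziobek y m) :=
    (contDiff_dziobek_left m).differentiable one_ne_zero
  have hleft : HasFDerivAt (fun y => dziobek (swap12CLM y) m) _ x :=
    (hd (swap12CLM x)).hasFDerivAt.comp x swap12CLM.hasFDerivAt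
  have hright : HasFDerivAt (fun y => swap12CLM (dziobek y m)) _ x :=
    swap12CLM.hasFDerivAt.comp x (hd x).hasFDerivAt
  simp only [swap12CLM_apply, dziobek_swap12] at hleft hright
  rw [jacobian_mulVec, jacobian_mulVec, ← swap12CLM_apply v, ← swap12CLM_apply (fderiv _ _ _ _)]
  exact congrArg (fun T => T v) (hleft.unique hright)

theorem det_jacobian_swap12 (hdet : (jacobian dziobek x m).det = 0) :
    (jacobian dziobek (swap12 x) m).det = 0 := by
  obtain ⟨v, hv, hJv⟩ := Matrix.exists_mulVec_eq_zero_iff.2 hdet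
  refine Matrix.exists_mulVec_eq_zero_iff.1 ⟨swap12 v, fun h => hv ?_, ?_⟩
  · rw [← swap12_involutive v, h, swap12_zero]
  · rw [jacobian_swap12_mulVec, hJv, swap12_zero]

theorem swap12_eq_of_singular (hx : x ∈ xBox) (hm : m ∈ mBox) (hF : dziobek x m = 0)
    (hdet : (jacobian dziobek x m).det = 0) : swap12 x = x :=
  (eq_of_singular hx hm hF hdet (swap12_mem_xBox hx) hm (by rw [dziobek_swap12, hF, swap12_zero])
    (det_jacobian_swap12 hdet)).1

theorem exists_isCentralConfiguration (hx : x ∈ xBox) (hm : m ∈ mBox) (hF : dziobek x m = 0)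
    (hsym : swap12 x = x) : ∃ q : Fin 4 → EuclideanSpace ℝ (Fin 2),
      HasMutualDistances q x ∧ IsCentralConfiguration (mass m) q ∧
        q 2 ∈ interior (convexHull ℝ {q 0, q 1, q 3}) := by
  have h5 : x 5 = x 3 := congrFun hsym 3
  have h6 : x 6 = x 4 := congrFun hsym 4
  have hS : cayleyMenger x = 0 := congrFun hF 1
  obtain ⟨-, -, ⟨h2, h2'⟩, ⟨h3, h3'⟩, ⟨h4, -⟩, -, -, ⟨h7, h7'⟩⟩ := hx
  have hm0 : 0 < m := lt_of_lt_of_le (by norm_num) hm.1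
  norm_num at h2 h2' h3 h3' h4 h7 h7'
  have hpos : ∀ k, 2 ≤ k → 0 < x k := by
    intro k hk
    fin_cases k <;> first | exact absurd hk (by decide) | (simp [h5, h6]; linarith)
  obtain ⟨p, y, z, hp, hy, hyz, hq⟩ := exists_kite_hasMutualDistances hpos h5 h6 hS (by linarith)
    (by nlinarith) (by nlinarith)
  exact ⟨kite p y z, hq, hq.isCentralConfiguration hm0 hpos hF,
    kite_two_mem_interior_convexHull hp hy hyz⟩

end Symmetry

end FourBody

theorem mainTheorem2 :
    ∃ x : Fin 8 → ℝ, ∃ m : ℝ,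
      -- existence and uniqueness of the singular solution in the box
      (x ∈ xBox ∧ m ∈ mBox ∧ dziobek x m = 0 ∧ (jacobian dziobek x m).det = 0) ∧
      (∀ y : Fin 8 → ℝ, ∀ m' : ℝ, y ∈ xBox → m' ∈ mBox → dziobek y m' = 0 →
        (jacobian dziobek y m').det = 0 → y = x ∧ m' = m) ∧
      -- it is a symmetric central configuration with the third body inside the triangle
      swap12 x = x ∧
      (∃ q : Fin 4 → EuclideanSpace ℝ (Fin 2),
        HasMutualDistances q x ∧ IsCentralConfiguration (mass m) q ∧
        q 2 ∈ interior (convexHull ℝ {q 0, q 1, q 3})) ∧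
      -- the kernel is one-dimensional, and the transversality conditions hold
      Module.finrank ℝ (LinearMap.ker (jacobian dziobek x m).mulVecLin) = 1 ∧
      (∃ v ∈ vBox, ∃ w ∈ wBox,
        (jacobian dziobek x m).mulVec v = 0 ∧ (jacobian dziobek x m).transpose.mulVec w = 0 ∧
        w ⬝ᵥ deriv (fun t => dziobek x t) m ≠ 0 ∧
        w ⬝ᵥ fderiv ℝ (fderiv ℝ (fun y => dziobek y m)) x v v ≠ 0 ∧
        w ⬝ᵥ deriv (fun t => dziobek x t) m ∈ decimalInterval (-6.501134640) 9 ∧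
        w ⬝ᵥ fderiv ℝ (fderiv ℝ (fun y => dziobek y m)) x v v ∈
          decimalInterval (-2066.64414) 5) ∧
      -- the fold: two solutions for masses below `m`, none for masses above `m`
      IsFoldBifurcation dziobek x m (-1) := by
  obtain ⟨x, m, v, hz, hF, hv7, hv⟩ := exists_singular_mem_solutionBox
  obtain ⟨hx, hm⟩ := mem_xBox_and_mem_mBox hz
  have hv0 : v ≠ 0 := by
    rintro rfl
    exact zero_ne_one hv7
  have hdet : (jacobian dziobek x m).det = 0 := Matrix.exists_mulVec_eq_zero_iff.1 ⟨v, hv0, hv⟩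
  have hB := det_updateRow_jacobian_ne_zero hx hm
  obtain ⟨w, hw, hw7, hwb⟩ := exists_leftNullVector hz hdet
  have hFm := dotProduct_deriv_mass_mem hz hwb
  have hFvv := dotProduct_fderiv_fderiv_mem hz hwb
  have hFm_neg : w ⬝ᵥ deriv (fun t => dziobek x t) m < 0 := hFm.2.trans_lt (by norm_num)
  have hFvv_neg : w ⬝ᵥ fderiv ℝ (fderiv ℝ (fun y => dziobek y m)) x v v < 0 :=
    hFvv.2.trans_lt (by norm_num)
  have hsym := swap12_eq_of_singular hx hm hF hdet
  exact ⟨x, m, ⟨hx, hm, hF, hdet⟩, fun y m' hy hm' hF' hdet' =>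
      eq_of_singular hx hm hF hdet hy hm' hF' hdet',
    hsym, exists_isCentralConfiguration hx hm hF hsym, finrank_ker_mulVecLin_eq_one hB hv hv7,
    ⟨v, mem_vBox hz hv7, w, mem_wBox hwb hw7, hv, hw, hFm_neg.ne, hFvv_neg.ne, hFm, hFvv⟩,
    isFoldBifurcation_dziobek hF hv0 (fun u hu => eq_smul_of_mulVec_eq_zero hB hu hv hv7) hw
      hFm_neg hFvv_neg⟩
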